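/- Let $\rho$ be a Borel probability measure on $\mathbb R$ with an exponential moment, i.e. $\int e^{\eta|y|}\,d\rho(y)<\infty$ for some $\eta>0$, and with positive drift $\lambda=\int_{\mathbb R} y\,d\rho(y)>0$. Write $\widehat\rho(z)=\int_{\mathbb R} e^{-zy}\,d\rho(y)$ for its Fourier–Laplace transform, let $\widetilde\rho$ be the image of $\rho$ under $y\mapsto -y$, let $G=\sum_{n\ge 0}\widetilde\rho^{\star n}$ (with $\widetilde\rho^{\star 0}=\delta_0$) be the Green kernel, and let $T_\lambda$ be the measure with density $\frac1\lambda\mathbf 1_{(-\infty,0]}$ with respect to Lebesgue measure. Call $\rho$ weakly diophantine if there is a real $l\ge 0$ with $\liminf_{b\to\pm\infty}|b|^l\,|1-\widehat\rho(ib)|>0$. A tempered distribution $T\in\mathcal S'(\mathbb R)$ is said to be of fast decrease if $T\star f\in\mathcal S(\mathbb R)$ for every $f\in\mathcal S(\mathbb R)$, where $(T\star f)(x)=\langle T,f(x-\cdot)\rangle$. Then every Schwartz function is integrable with respect to $G$ and to $T_\lambda$, and $f\mapsto\int f\,dG-\int f\,dT_\lambda$ is a tempered distribution, denoted $G-T_\lambda$.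 It is of fast decrease if and only if $\rho$ is weakly diophantine. Moreover, in this case, $\widehat\rho(-i\xi)\neq 1$ for every real $\xi\ne0$, and the Fourier transform of $G-T_\lambda$ (in the normalisation $\widehat f(i\xi)=\int f(x)e^{-i\xi x}\,dx$) is the smooth function, with all derivatives of at most polynomial growth, given for $\xi\neq 0$ by $$\widehat{G-T_\lambda}(i\xi)=\frac{1}{1-\widehat\rho(-i\xi)}+\frac1\lambda\,\frac{1}{i\xi},$$ that is, $\langle G-T_\lambda,\widehat\varphi\rangle=\int_{\mathbb R}\widehat{G-T_\lambda}(i\xi)\,\varphi(\xi)\,d\xi$ for all $\varphi\in\mathcal S(\mathbb R)$, where $\widehat\varphi(x)=\int_{\mathbb R}\varphi(\xi)e^{-ix\xi}\,d\xi$. -/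

import Mathlib

open MeasureTheory Filter Topology
open scoped SchwartzMap FourierTransform

noncomputable section

namespace Renewal

/-- `ρ` has an exponential moment (of some positive order). -/
def HasExponentialMoment (ρ : Measure ℝ) : Prop :=
  ∃ η : ℝ, 0 < η ∧ Integrable (fun y : ℝ => Real.exp (η * |y|)) ρ

/-- The drift `∫ y dρ(y)`. -/
def drift (ρ : Measure ℝ) : ℝ := ∫ y, y ∂ρ

/-- The Fourier-Laplace transform `z ↦ ∫ e^{-zy} dρ(y)`. -/
def laplace (ρ : Measure ℝ) (z : ℂ) : ℂ := ∫ y : ℝ, Complex.exp (-z * (y : ℂ)) ∂ρ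

/-- `liminf_{b → ±∞} |b|^l |1 - ρ̂(ib)| > 0`, the liminf being taken in `[-∞, +∞]`. -/
def IsWeaklyDiophantineOfOrder (ρ : Measure ℝ) (l : ℝ) : Prop :=
  0 < liminf (fun b : ℝ => ((|b| ^ l * ‖1 - laplace ρ (Complex.I * (b : ℂ))‖ : ℝ) : EReal))
    (atBot ⊔ atTop)

def IsWeaklyDiophantine (ρ : Measure ℝ) : Prop :=
  ∃ l : ℝ, 0 ≤ l ∧ IsWeaklyDiophantineOfOrder ρ l

/-- The convolution powers `ρ^{⋆n}`, with `ρ^{⋆0} = δ₀`. -/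
def convPow (ρ : Measure ℝ) : ℕ → Measure ℝ
  | 0 => Measure.dirac 0
  | n + 1 => (convPow ρ n).conv ρ

/-- The image of `ρ` under `y ↦ -y`. -/
def reflected (ρ : Measure ℝ) : Measure ℝ := ρ.map (fun y => -y)

/-- The Green kernel `∑ₙ ρ̃^{⋆n}`, a measure on `ℝ`. -/
def greenKernel (ρ : Measure ℝ) : Measure ℝ :=
  Measure.sum (fun n : ℕ => convPow (reflected ρ) n)

/-- The measure with density `(1/c) 1_{(-∞,0]}` with respect to Lebesgue measure. -/
def halfLine (c : ℝ) : Measure ℝ :=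
  ENNReal.ofReal (1 / c) • (volume : Measure ℝ).restrict (Set.Iic 0)

/-- The tempered distribution `D` is the difference of the (possibly infinite) measures `μ`, `ν`:
every Schwartz function is integrable for both, and `⟨D, φ⟩ = ∫ φ dμ - ∫ φ dν`. -/
def IsDifference (D : 𝓢'(ℝ, ℂ)) (μ ν : Measure ℝ) : Prop :=
  ∀ φ : 𝓢(ℝ, ℂ), Integrable (fun x => φ x) μ ∧ Integrable (fun x => φ x) ν ∧
    D φ = (∫ x, φ x ∂μ) - ∫ x, φ x ∂ν

/-- The Schwartz function `y ↦ f (x - y)`. -/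
def reflectTranslate (f : 𝓢(ℝ, ℂ)) (x : ℝ) : 𝓢(ℝ, ℂ) :=
  SchwartzMap.compSubConstCLM ℂ x
    (SchwartzMap.compCLMOfContinuousLinearEquiv ℂ (ContinuousLinearEquiv.neg ℝ (M := ℝ)) f)

theorem reflectTranslate_apply (f : 𝓢(ℝ, ℂ)) (x y : ℝ) :
    reflectTranslate f x y = f (x - y) := by
  simp [reflectTranslate, SchwartzMap.compSubConstCLM_apply]

/-- The convolution `(D ⋆ f)(x) = ⟨D, f(x - ·)⟩`. -/
def distConv (D : 𝓢'(ℝ, ℂ)) (f : 𝓢(ℝ, ℂ)) (x : ℝ) : ℂ := D (reflectTranslate f x)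

/-- `D` is of fast decrease: `D ⋆ f` is a Schwartz function for every Schwartz function `f`. -/
def IsOfFastDecrease (D : 𝓢'(ℝ, ℂ)) : Prop :=
  ∀ f : 𝓢(ℝ, ℂ), ∃ g : 𝓢(ℝ, ℂ), ∀ x : ℝ, g x = distConv D f x

/-- The dilation `x ↦ x / (2π)`. -/
def dilation : ℝ ≃L[ℝ] ℝ :=
  ContinuousLinearEquiv.unitsEquivAut ℝ (Units.mk0 (1 / (2 * Real.pi)) (by positivity))

/-- The Schwartz function `x ↦ ∫ φ(ξ) e^{-ixξ} dξ` (Mathlib's `𝓕` has `2π` in the exponent). -/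
def angularFourier (φ : 𝓢(ℝ, ℂ)) : 𝓢(ℝ, ℂ) :=
  SchwartzMap.compCLMOfContinuousLinearEquiv ℂ dilation (𝓕 φ)

theorem angularFourier_apply (φ : 𝓢(ℝ, ℂ)) (x : ℝ) :
    angularFourier φ x = ∫ ξ : ℝ, Complex.exp (-(Complex.I * (x : ℂ) * (ξ : ℂ))) * φ ξ := by
  have h : angularFourier φ x = (𝓕 (φ : ℝ → ℂ)) (x * (1 / (2 * Real.pi))) := by
    simp [angularFourier, dilation, SchwartzMap.fourier_coe]
  rw [h, Real.fourier_real_eq_integral_exp_smul]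
  refine integral_congr_ae (Eventually.of_forall fun ξ => ?_)
  have hpi : (Real.pi : ℂ) ≠ 0 := by exact_mod_cast Real.pi_ne_zero
  simp only [smul_eq_mul]
  congr 2
  push_cast
  field_simp

/-- The Fourier transform of the tempered distribution `D`, in the normalisation
`D̂(iξ) = ∫ e^{-iξx} dD(x)`, is the function `U`:
`⟨D, φ̂⟩ = ∫ U(ξ) φ(ξ) dξ` for every Schwartz function `φ`. -/
def HasFourierTransform (D : 𝓢'(ℝ, ℂ)) (U : ℝ → ℂ) : Prop :=
  ∀ φ : 𝓢(ℝ, ℂ), Integrable (fun ξ : ℝ => U ξ * φ ξ) ∧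
    D (angularFourier φ) = ∫ ξ : ℝ, U ξ * φ ξ

end Renewal

end

noncomputable section

namespace Renewal

open scoped ContDiff

/-! ### Functions of polynomial growth -/

/-! Write P(ξ) for `charFun ρ ξ`, which is ρ̂(-iξ), and λ for the drift. Taylor's formula gives 1 -
P = -iξH with H = λ + iξK, where K is an oscillatory integral; since all moments of ρ are finite, K
is smooth with bounded derivatives. Then 1/(1 - P) + 1/(iλξ) = K/(λH): the pole at 0 has cancelled,
and only the size of 1/H matters.

If ρ is weakly diophantine, |H| has a polynomial lower bound at infinity. H has no zero: H(0) = λ,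
and P(ξ) = 1 with ξ ≠ 0 would give P = 1 at all multiples nξ, arbitrarily far out. So U = K/(λH) has
temperate growth (`Function.HasTemperateGrowth.inv_of_le`). It is the Fourier transform of G - T_λ
by Abel summation: weight the n-th convolution power by (1 - λε)^n and the half line by e^{εx}, and
let ε → 0, with domination from `IsWeaklyDiophantine.norm_abelSymbol_le`. Convolution by G - T_λ
then multiplies by U(-ξ) on the Fourier side, which preserves Schwartz functions.

Conversely, let g = (G - T_λ) ⋆ f' be Schwartz. The renewal equation G = δ₀ + G ⋆ ρ̃ yields (1 - P)ĝ
= (iξ + (1 - P)/λ)f̂. The factor of f̂ is at least 1 in modulus far out and ĝ is bounded, so every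
Schwartz function is O(|1 - P|) at infinity. By `exists_one_le_pow_mul_of_schwartz_le`, |1 - P| is
then bounded below by a negative power of |ξ|.

That G integrates Schwartz functions at all comes from Chernoff's bound
(`hasTemperateGrowth_greenKernel`). -/

/-- `f` is bounded by a polynomial. -/
def PolyBounded (f : ℝ → ℂ) : Prop :=
  ∃ (k : ℕ) (C : ℝ), ∀ x, ‖f x‖ ≤ C * (1 + ‖x‖) ^ k

theorem PolyBounded.exists_nonneg {f : ℝ → ℂ} (hf : PolyBounded f) :
    ∃ (k : ℕ) (C : ℝ), 0 ≤ C ∧ ∀ x, ‖f x‖ ≤ C * (1 + ‖x‖) ^ k := by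
  obtain ⟨k, C, h⟩ := hf
  exact ⟨k, C, by simpa using (norm_nonneg _).trans (h 0), h⟩

theorem PolyBounded.add {f g : ℝ → ℂ} (hf : PolyBounded f) (hg : PolyBounded g) :
    PolyBounded (fun x => f x + g x) := by
  obtain ⟨k, C, hC, h⟩ := hf.exists_nonneg
  obtain ⟨l, C', hC', h'⟩ := hg.exists_nonneg
  refine ⟨max k l, C + C', fun x => (norm_add_le _ _).trans ?_⟩
  have h1 : 1 ≤ 1 + ‖x‖ := by simp
  rw [add_mul]
  gcongr
  · exact (h x).trans (by gcongr; exact le_max_left _ _)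
  · exact (h' x).trans (by gcongr; exact le_max_right _ _)

theorem PolyBounded.mul {f g : ℝ → ℂ} (hf : PolyBounded f) (hg : PolyBounded g) :
    PolyBounded (fun x => f x * g x) := by
  obtain ⟨k, C, hC, h⟩ := hf.exists_nonneg
  obtain ⟨l, C', hC', h'⟩ := hg.exists_nonneg
  refine ⟨k + l, C * C', fun x => ?_⟩
  rw [norm_mul, pow_add, mul_mul_mul_comm]
  exact mul_le_mul (h x) (h' x) (norm_nonneg _) (by positivity)

theorem PolyBounded.const (c : ℂ) : PolyBounded (fun _ => c) :=
  ⟨0, ‖c‖, fun x => by simp⟩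

theorem PolyBounded.sum {ι : Type*} (s : Finset ι) {f : ι → ℝ → ℂ}
    (hf : ∀ i ∈ s, PolyBounded (f i)) : PolyBounded (fun x => ∑ i ∈ s, f i x) := by
  classical
  induction s using Finset.induction_on with
  | empty => simpa using PolyBounded.const 0
  | insert a s ha ih =>
    simp only [Finset.sum_insert ha]
    exact (hf a (by simp)).add (ih fun i hi => hf i (by simp [hi]))

theorem hasTemperateGrowth_iff_iteratedDeriv {f : ℝ → ℂ} :
    f.HasTemperateGrowth ↔ ContDiff ℝ ∞ f ∧ ∀ n : ℕ, PolyBounded (iteratedDeriv n f) := by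
  simp only [Function.HasTemperateGrowth, PolyBounded, norm_iteratedFDeriv_eq_norm_iteratedDeriv]

/-- Leibniz' rule for f · f⁻¹ = 1 expresses the n-th derivative of f⁻¹ as f⁻¹ times products of
derivatives of f with lower derivatives of f⁻¹. Strong induction then needs only the bound on f⁻¹
itself. -/
theorem _root_.Function.HasTemperateGrowth.inv_of_le {f : ℝ → ℂ} (hf : f.HasTemperateGrowth)
    {c : ℝ} (hc : 0 < c) {m : ℕ} (h : ∀ x, c ≤ ‖f x‖ * (1 + ‖x‖) ^ m) :
    (fun x => (f x)⁻¹).HasTemperateGrowth := by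
  have hne : ∀ x, f x ≠ 0 := fun x hx => by
    have := h x
    simp only [hx, norm_zero, zero_mul] at this
    linarith
  obtain ⟨hs, hb⟩ := hasTemperateGrowth_iff_iteratedDeriv.1 hf
  have hgs : ContDiff ℝ ∞ (fun x => (f x)⁻¹) := hs.inv hne
  refine hasTemperateGrowth_iff_iteratedDeriv.2 ⟨hgs, fun n => ?_⟩
  have hg0 : PolyBounded (fun x => (f x)⁻¹) := by
    refine ⟨m, c⁻¹, fun x => ?_⟩
    have := norm_pos_iff.2 (hne x)
    rw [norm_inv, inv_mul_eq_div, inv_eq_one_div, div_le_div_iff₀ this hc, one_mul, mul_comm]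
    exact h x
  induction n using Nat.strong_induction_on with
  | _ n ih =>
    rcases Nat.eq_zero_or_pos n with rfl | hn
    · simpa using hg0
    have key : ∀ x, iteratedDeriv n (fun x => (f x)⁻¹) x = (f x)⁻¹ * ((-1) *
        ∑ i ∈ Finset.range n, (n.choose (i + 1) : ℂ) * iteratedDeriv (i + 1) f x *
          iteratedDeriv (n - (i + 1)) (fun x => (f x)⁻¹) x) := by
      intro x
      have h1 := iteratedDeriv_mul (n := n) (x := x)
        (hs.contDiffAt.of_le (by exact_mod_cast le_top))
        (hgs.contDiffAt.of_le (by exact_mod_cast le_top))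
      have h2 : (f * fun x => (f x)⁻¹) = fun _ => 1 := by
        ext x
        simp [hne x]
      rw [h2, Finset.sum_range_succ', iteratedDeriv_const, if_neg hn.ne'] at h1
      simp only [Nat.choose_zero_right, Nat.cast_one, one_mul, iteratedDeriv_zero,
        Nat.sub_zero] at h1
      rw [eq_inv_mul_iff_mul_eq₀ (hne x)]
      linear_combination -h1
    rw [funext key]
    refine hg0.mul ((PolyBounded.const _).mul (PolyBounded.sum _ fun i hi => ?_))
    exact ((PolyBounded.const _).mul (hb _)).mul (ih _ (by omega))

/-! ### Oscillatory integrals -/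

section Oscillatory

variable {Ω : Type*} [MeasurableSpace Ω] {μ : Measure Ω} {X : Ω → ℝ} {W : Ω → ℂ}

theorem hasDerivAt_integral_mul_exp (hX : AEStronglyMeasurable X μ) (hW : Integrable W μ)
    (hWX : Integrable (fun a => W a * X a) μ) (ξ : ℝ) :
    HasDerivAt (fun ξ : ℝ => ∫ a, W a * Complex.exp (ξ * X a * Complex.I) ∂μ)
      (∫ a, (W a * (X a * Complex.I)) * Complex.exp (ξ * X a * Complex.I) ∂μ) ξ := by
  have hXc : AEStronglyMeasurable (fun a => (X a : ℂ)) μ :=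
    Complex.continuous_ofReal.comp_aestronglyMeasurable hX
  have hE : ∀ ξ : ℝ, AEStronglyMeasurable (fun a => Complex.exp (ξ * X a * Complex.I)) μ :=
    fun ξ => Complex.continuous_exp.comp_aestronglyMeasurable
      ((hXc.const_mul _).mul_const _)
  have hn : ∀ (ξ : ℝ) a, ‖Complex.exp (ξ * X a * Complex.I)‖ = 1 := fun ξ a => by
    rw [← Complex.ofReal_mul, Complex.norm_exp_ofReal_mul_I]
  refine (hasDerivAt_integral_of_dominated_loc_of_deriv_le (bound := fun a => ‖W a * X a‖)
    (F := fun (ξ : ℝ) a => W a * Complex.exp (ξ * X a * Complex.I))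
    (F' := fun (ξ : ℝ) a => (W a * (X a * Complex.I)) * Complex.exp (ξ * X a * Complex.I))
    (s := Set.univ) Filter.univ_mem (Eventually.of_forall fun ξ => hW.1.mul (hE ξ)) ?_ ?_ ?_
    hWX.norm ?_).2
  · exact hW.mono (hW.1.mul (hE ξ)) (Eventually.of_forall fun a => by rw [norm_mul, hn, mul_one])
  · exact (hW.1.mul (hXc.mul_const _)).mul (hE ξ)
  · refine Eventually.of_forall fun a ξ _ => ?_
    rw [norm_mul, hn, mul_one, ← mul_assoc, norm_mul, Complex.norm_I, mul_one]
  · refine Eventually.of_forall fun a ξ _ => ?_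
    have h1 : HasDerivAt (fun ξ : ℝ => (ξ : ℂ) * X a * Complex.I) (X a * Complex.I) ξ := by
      simpa [mul_assoc] using (Complex.ofRealCLM.hasDerivAt (x := ξ)).mul_const (X a * Complex.I)
    have := (h1.cexp).const_mul (W a)
    rw [mul_assoc, mul_comm (_ * _) (Complex.exp _)]
    exact this

/-- Each derivative in ξ brings down a factor iX, and the exponential has modulus 1, so finite
moments of X against W bound every derivative uniformly in ξ. -/
theorem hasTemperateGrowth_integral_mul_exp (hX : AEStronglyMeasurable X μ)
    (hW : ∀ n : ℕ, Integrable (fun a => W a * (X a : ℂ) ^ n) μ) :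
    (fun ξ : ℝ => ∫ a, W a * Complex.exp (ξ * X a * Complex.I) ∂μ).HasTemperateGrowth := by
  have hW' : ∀ n : ℕ, Integrable (fun a => W a * (X a * Complex.I) ^ n) μ := fun n => by
    simpa only [mul_pow, mul_assoc] using (hW n).mul_const (Complex.I ^ n)
  have hd : ∀ (n : ℕ) (ξ : ℝ), HasDerivAt
      (fun ξ : ℝ => ∫ a, W a * (X a * Complex.I) ^ n * Complex.exp (ξ * X a * Complex.I) ∂μ)
      (∫ a, W a * (X a * Complex.I) ^ (n + 1) * Complex.exp (ξ * X a * Complex.I) ∂μ) ξ := by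
    intro n ξ
    have := hasDerivAt_integral_mul_exp hX (hW' n) (by
      have := (hW' (n + 1)).mul_const (-Complex.I)
      refine this.congr (Eventually.of_forall fun a => ?_)
      simp only [pow_succ]
      linear_combination -(W a * (X a * Complex.I) ^ n * X a) * Complex.I_mul_I) ξ
    simpa only [pow_succ, mul_assoc] using this
  have hi : ∀ n : ℕ, iteratedDeriv n
      (fun ξ : ℝ => ∫ a, W a * Complex.exp (ξ * X a * Complex.I) ∂μ) =
      fun ξ : ℝ => ∫ a, W a * (X a * Complex.I) ^ n * Complex.exp (ξ * X a * Complex.I) ∂μ := by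
    intro n
    induction n with
    | zero => simp
    | succ n ih =>
      rw [iteratedDeriv_succ, ih]
      exact funext fun ξ => (hd n ξ).deriv
  refine hasTemperateGrowth_iff_iteratedDeriv.2 ⟨?_, fun n => ?_⟩
  · refine contDiff_of_differentiable_iteratedDeriv fun n _ => ?_
    rw [hi n]
    exact fun ξ => (hd n ξ).differentiableAt
  · rw [hi n]
    refine ⟨0, ∫ a, ‖W a * (X a * Complex.I) ^ n‖ ∂μ, fun ξ => ?_⟩
    rw [pow_zero, mul_one]
    refine (norm_integral_le_integral_norm _).trans_eq (integral_congr_ae ?_)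
    refine Eventually.of_forall fun a => ?_
    simp only [norm_mul _ (Complex.exp _)]
    rw [← Complex.ofReal_mul, Complex.norm_exp_ofReal_mul_I, mul_one]

end Oscillatory

/-! ### Schwartz functions of slow decay along a sequence -/

theorem exists_schwartz_eq_tsum {f : ℕ → 𝓢(ℝ, ℂ)}
    (hf : ∀ k n : ℕ, Summable fun i => SchwartzMap.seminorm ℝ k n (f i)) :
    ∃ g : 𝓢(ℝ, ℂ), ∀ x, HasSum (fun i => f i x) (g x) := by
  have hb : ∀ (n i : ℕ) (x : ℝ), ‖iteratedFDeriv ℝ n (f i) x‖ ≤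
      SchwartzMap.seminorm ℝ 0 n (f i) :=
    fun n i x => SchwartzMap.norm_iteratedFDeriv_le_seminorm ℝ _ _ _
  have hc : ContDiff ℝ ∞ fun x => ∑' i, f i x :=
    contDiff_tsum (v := fun n i => SchwartzMap.seminorm ℝ 0 n (f i))
      (fun i => (f i).smooth ⊤) (fun n _ => hf 0 n) (fun n i x _ => hb n i x)
  refine ⟨⟨fun x => ∑' i, f i x, hc, fun k n => ?_⟩, fun x => ?_⟩
  · refine ⟨∑' i, SchwartzMap.seminorm ℝ k n (f i), fun x => ?_⟩
    rw [iteratedFDeriv_tsum_apply (N := ⊤) (v := fun n i => SchwartzMap.seminorm ℝ 0 n (f i))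
      (fun i => (f i).smooth ⊤) (fun n _ => hf 0 n) (fun n i x _ => hb n i x) le_top]
    have hs : Summable fun i => ‖iteratedFDeriv ℝ n (f i) x‖ :=
      (hf 0 n).of_nonneg_of_le (fun _ => norm_nonneg _) fun i => hb n i x
    calc ‖x‖ ^ k * ‖∑' i, iteratedFDeriv ℝ n (f i) x‖
        ≤ ‖x‖ ^ k * ∑' i, ‖iteratedFDeriv ℝ n (f i) x‖ := by
          gcongr
          exact norm_tsum_le_tsum_norm hs
      _ = ∑' i, ‖x‖ ^ k * ‖iteratedFDeriv ℝ n (f i) x‖ := by rw [tsum_mul_left]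
      _ ≤ _ := (hs.mul_left _).tsum_le_tsum
          (fun i => SchwartzMap.le_seminorm ℝ k n (f i) x) (hf k n)
  · refine (Summable.of_norm ((hf 0 0).of_nonneg_of_le (fun _ => norm_nonneg _) fun i => ?_)).hasSum
    exact SchwartzMap.norm_le_seminorm ℝ _ _

/-- Since 1 + |x| ≤ (1 + |b|)(1 + |x - b|), translating by b costs only a power of |b|, which the
rapidly decreasing heights of the bumps below absorb. -/
theorem exists_seminorm_compSubConst_le (f : 𝓢(ℝ, ℂ)) (k n : ℕ) :
    ∃ C : ℝ, 0 ≤ C ∧ ∀ b : ℝ, SchwartzMap.seminorm ℝ k n (SchwartzMap.compSubConstCLM ℂ b f) ≤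
      C * (1 + |b|) ^ k := by
  set S := (Finset.Iic (k, n)).sup (fun m => SchwartzMap.seminorm ℝ m.1 m.2) f
  have hS : 0 ≤ S := apply_nonneg _ _
  refine ⟨2 ^ k * S, by positivity, fun b => ?_⟩
  refine SchwartzMap.seminorm_le_bound ℝ _ _ _ (by positivity) fun x => ?_
  have h1 : iteratedFDeriv ℝ n (SchwartzMap.compSubConstCLM ℂ b f) x =
      iteratedFDeriv ℝ n f (x - b) := by
    have : ⇑(SchwartzMap.compSubConstCLM ℂ b f) = fun x => f (x - b) :=
      funext fun x => SchwartzMap.compSubConstCLM_apply f b x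
    rw [this, iteratedFDeriv_comp_sub]
  have h2 := SchwartzMap.one_add_le_sup_seminorm_apply (𝕜 := ℝ) (m := (k, n)) (k := k) (n := n)
    le_rfl le_rfl f (x - b)
  rw [h1]
  calc ‖x‖ ^ k * ‖iteratedFDeriv ℝ n f (x - b)‖
      ≤ ((1 + |b|) * (1 + ‖x - b‖)) ^ k * ‖iteratedFDeriv ℝ n f (x - b)‖ := by
        gcongr
        have : |x| ≤ |x - b| + |b| := by simpa using abs_add_le (x - b) b
        simp only [Real.norm_eq_abs]
        nlinarith [abs_nonneg b, abs_nonneg (x - b)]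
    _ = (1 + ‖x - b‖) ^ k * ‖iteratedFDeriv ℝ n f (x - b)‖ * (1 + |b|) ^ k := by
        rw [mul_pow]
        ring
    _ ≤ 2 ^ k * S * (1 + |b|) ^ k := by gcongr

/-- Nonnegativity excludes cancellation when translates are added up. -/
theorem exists_schwartz_bump : ∃ χ : 𝓢(ℝ, ℂ), χ 0 = 1 ∧ ∀ x, 0 ≤ (χ x).re := by
  let χ : ContDiffBump (0 : ℝ) := ⟨1, 2, one_pos, one_lt_two⟩
  have h1 : ContDiff ℝ ∞ fun x => (χ x : ℂ) := Complex.ofRealCLM.contDiff.comp χ.contDiff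
  have h2 : HasCompactSupport fun x => (χ x : ℂ) :=
    χ.hasCompactSupport.comp_left (g := fun x : ℝ => (x : ℂ)) Complex.ofReal_zero
  refine ⟨h2.toSchwartzMap h1, ?_, fun x => ?_⟩
  · simpa using χ.one_of_mem_closedBall (by simp [χ])
  · simpa using χ.nonneg

/-- If every Schwartz function is dominated by `w` far from the origin, then `w` decays
at most polynomially. -/
theorem exists_one_le_pow_mul_of_schwartz_le {w : ℝ → ℝ} (hw : ∀ x, 0 ≤ w x) {R : ℝ}
    (h : ∀ φ : 𝓢(ℝ, ℂ), ∃ C : ℝ, ∀ x, R ≤ |x| → ‖φ x‖ ≤ C * w x) :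
    ∃ (N : ℕ) (R' : ℝ), ∀ b, R' ≤ |b| → 1 ≤ |b| ^ N * w b := by
  by_contra! hcon
  -- The exponent 2i leaves a margin over the bump height |b i|^(-i); the radius 2^i supplies the
  -- geometric convergence.
  choose b hb hbw using fun i : ℕ => hcon (2 * i) (max R (2 ^ i))
  have hb2 : ∀ i, 2 ^ i ≤ |b i| := fun i => (le_max_right _ _).trans (hb i)
  have hb1 : ∀ i, 1 ≤ |b i| := fun i => (one_le_pow₀ one_le_two).trans (hb2 i)
  have hb0 : ∀ i, 0 < |b i| := fun i => one_pos.trans_le (hb1 i)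
  obtain ⟨χ, hχ0, hχ⟩ := exists_schwartz_bump
  let f : ℕ → 𝓢(ℝ, ℂ) := fun i => (|b i| ^ i)⁻¹ • SchwartzMap.compSubConstCLM ℂ (b i) χ
  have hf : ∀ k n : ℕ, Summable fun i => SchwartzMap.seminorm ℝ k n (f i) := by
    intro k n
    obtain ⟨C, hC, hCb⟩ := exists_seminorm_compSubConst_le χ k n
    refine Summable.of_norm_bounded_eventually_nat (g := fun i => C * 2 ^ k * (1 / 2) ^ i)
      (summable_geometric_two.mul_left _) ?_
    -- Of the i ≥ k + 1 factors |b i|, k pay for the translation and the spare one, at least 2^i,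
    -- gives a geometric majorant.
    filter_upwards [eventually_ge_atTop (k + 1)] with i hi
    rw [Real.norm_of_nonneg (apply_nonneg _ _), map_smul_eq_mul,
      Real.norm_of_nonneg (by positivity), inv_mul_le_iff₀ (by have := hb0 i; positivity)]
    calc SchwartzMap.seminorm ℝ k n (SchwartzMap.compSubConstCLM ℂ (b i) χ)
        ≤ C * (1 + |b i|) ^ k := hCb _
      _ ≤ C * (2 * |b i|) ^ k := by gcongr; linarith [hb1 i]
      _ = C * 2 ^ k * |b i| ^ k := by ring
      _ ≤ C * 2 ^ k * (|b i| ^ (k + 1) * (1 / 2) ^ i) := by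
          gcongr
          rw [pow_succ, mul_assoc]
          refine le_mul_of_one_le_right (by positivity) ?_
          rw [one_div, inv_pow, ← div_eq_mul_inv, one_le_div (by positivity)]
          exact hb2 i
      _ ≤ C * 2 ^ k * (|b i| ^ i * (1 / 2) ^ i) := by
          gcongr
          exact hb1 i
      _ = |b i| ^ i * (C * 2 ^ k * (1 / 2) ^ i) := by ring
  obtain ⟨g, hg⟩ := exists_schwartz_eq_tsum hf
  have hfre : ∀ i x, (f i x).re = (|b i| ^ i)⁻¹ * (χ (x - b i)).re := fun i x => by
    simp only [f, smul_apply, SchwartzMap.compSubConstCLM_apply, Complex.smul_re,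
      smul_eq_mul]
  have hge : ∀ i, (|b i| ^ i)⁻¹ ≤ ‖g (b i)‖ := by
    intro i
    have h1 : HasSum (fun j => (f j (b i)).re) (g (b i)).re := Complex.hasSum_re (hg (b i))
    have h2 := le_hasSum h1 i fun j _ => by
      rw [hfre]
      exact mul_nonneg (by positivity) (hχ _)
    rw [hfre, sub_self, hχ0, Complex.one_re, mul_one] at h2
    exact h2.trans (Complex.re_le_norm _)
  obtain ⟨C, hC⟩ := h g
  -- For i > 0, 2^i ≤ |b i| ≤ |b i|^i ≤ |C|. The summand 2 only serves i = 0, where the power |b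
  -- i|^i says nothing about |b i|.
  have hfin : ∀ i : ℕ, (2 : ℝ) ^ i ≤ |C| + 2 := by
    intro i
    rcases Nat.eq_zero_or_pos i with rfl | hi
    · rw [pow_zero]
      linarith [abs_nonneg C]
    have hpos : 0 < |b i| ^ i := pow_pos (hb0 i) i
    have h1 : (|b i| ^ i)⁻¹ ≤ |C| * w (b i) :=
      ((hge i).trans (hC _ ((le_max_left _ _).trans (hb i)))).trans
        (mul_le_mul_of_nonneg_right (le_abs_self C) (hw _))
    have h2 : |b i| ^ i ≤ |C| * (|b i| ^ (2 * i) * w (b i)) := by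
      have := mul_le_mul_of_nonneg_left h1 (pow_pos (hb0 i) (2 * i)).le
      calc |b i| ^ i = |b i| ^ (2 * i) * (|b i| ^ i)⁻¹ := by
            rw [two_mul, pow_add]
            field_simp
        _ ≤ _ := this
        _ = _ := by ring
    have h3 : |C| * (|b i| ^ (2 * i) * w (b i)) ≤ |C| * 1 := by
      gcongr
      exact (hbw i).le
    have h4 : |b i| ≤ |b i| ^ i := le_self_pow₀ (hb1 i) hi.ne'
    linarith [hb2 i]
  obtain ⟨i, hi⟩ := pow_unbounded_of_one_lt (|C| + 2) (one_lt_two (α := ℝ))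
  linarith [hfin i]

end Renewal

end

noncomputable section

namespace Renewal

/-! ### The Green kernel -/

instance isProbabilityMeasure_reflected (ρ : Measure ℝ) [IsProbabilityMeasure ρ] :
    IsProbabilityMeasure (reflected ρ) :=
  Measure.isProbabilityMeasure_map measurable_neg.aemeasurable

instance isProbabilityMeasure_convPow (ρ : Measure ℝ) [IsProbabilityMeasure ρ] (n : ℕ) :
    IsProbabilityMeasure (convPow ρ n) := by
  induction n with
  | zero => exact Measure.dirac.isProbabilityMeasure
  | succ n ih => exact inferInstanceAs (IsProbabilityMeasure ((convPow ρ n).conv ρ))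

theorem laplace_neg_I_mul (ρ : Measure ℝ) (ξ : ℝ) :
    laplace ρ (-(Complex.I * (ξ : ℂ))) = charFun ρ ξ := by
  rw [charFun_apply_real, laplace]
  congr! 3
  ring

theorem norm_one_sub_laplace_I_mul (ρ : Measure ℝ) (b : ℝ) :
    ‖1 - laplace ρ (Complex.I * (b : ℂ))‖ = ‖1 - charFun ρ b‖ := by
  have h : laplace ρ (Complex.I * (b : ℂ)) = charFun ρ (-b) := by
    rw [← laplace_neg_I_mul]
    simp
  rw [h, charFun_neg, ← Complex.norm_conj]
  simp

theorem charFun_reflected (ρ : Measure ℝ) (t : ℝ) : charFun (reflected ρ) t = charFun ρ (-t) := by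
  have := charFun_map_mul (μ := ρ) (-1) t
  simpa [reflected] using this

theorem charFun_convPow (ρ : Measure ℝ) [IsProbabilityMeasure ρ] (n : ℕ) (t : ℝ) :
    charFun (convPow ρ n) t = charFun ρ t ^ n := by
  induction n with
  | zero => simp [convPow, charFun_dirac]
  | succ n ih => rw [convPow, charFun_conv, ih, pow_succ]

theorem lintegral_exp_convPow (ρ : Measure ℝ) [IsProbabilityMeasure ρ] (t : ℝ) (n : ℕ) :
    ∫⁻ x, ENNReal.ofReal (Real.exp (t * x)) ∂(convPow ρ n) =
      (∫⁻ x, ENNReal.ofReal (Real.exp (t * x)) ∂ρ) ^ n := by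
  have hm : Measurable fun x : ℝ => ENNReal.ofReal (Real.exp (t * x)) := by fun_prop
  induction n with
  | zero => simp [convPow, lintegral_dirac' _ hm]
  | succ n ih =>
    rw [convPow, Measure.lintegral_conv hm, pow_succ, ← ih, ← lintegral_mul_const _ hm]
    refine lintegral_congr fun x => ?_
    rw [← lintegral_const_mul _ hm]
    refine lintegral_congr fun y => ?_
    rw [mul_add, Real.exp_add, ENNReal.ofReal_mul (Real.exp_nonneg _)]

theorem HasExponentialMoment.zero_mem_interior {ρ : Measure ℝ} [IsProbabilityMeasure ρ]
    (hexp : HasExponentialMoment ρ) :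
    (0 : ℝ) ∈ interior (ProbabilityTheory.integrableExpSet id ρ) := by
  obtain ⟨η, hη, hi⟩ := hexp
  refine mem_interior.2 ⟨Set.Ioo (-η) η, fun t ht => ?_, isOpen_Ioo, by simp [hη]⟩
  refine hi.mono (by fun_prop) (Eventually.of_forall fun y => ?_)
  simp only [Real.norm_eq_abs, Real.abs_exp, id]
  refine Real.exp_le_exp.2 ((le_abs_self _).trans ?_)
  rw [abs_mul]
  exact mul_le_mul_of_nonneg_right (abs_le.2 ⟨ht.1.le, ht.2.le⟩) (abs_nonneg _)

theorem HasExponentialMoment.integrable_pow {ρ : Measure ℝ} [IsProbabilityMeasure ρ]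
    (hexp : HasExponentialMoment ρ) (n : ℕ) : Integrable (fun y : ℝ => |y| ^ n) ρ :=
  ProbabilityTheory.integrable_pow_abs_of_mem_interior_integrableExpSet hexp.zero_mem_interior n

/-- Chernoff's estimate: some exponential moment of the reflected law is smaller than one. -/
theorem exists_lintegral_exp_lt_one {ρ : Measure ℝ} [IsProbabilityMeasure ρ]
    (hexp : HasExponentialMoment ρ) (hdrift : 0 < drift ρ) :
    ∃ t : ℝ, 0 < t ∧ ∃ q : ℝ, 0 < q ∧ q < 1 ∧
      ∫⁻ x, ENNReal.ofReal (Real.exp (t * x)) ∂(reflected ρ) = ENNReal.ofReal q := by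
  have h0 := hexp.zero_mem_interior
  have hd : HasDerivAt (ProbabilityTheory.mgf id ρ) (drift ρ) 0 := by
    have := ProbabilityTheory.hasDerivAt_mgf h0
    simpa [drift] using this
  -- The moment generating function equals 1 at 0 with slope the drift, so it drops below 1 just to
  -- the left of 0; reflection turns s into -s > 0.
  have h1 : ∀ᶠ s in 𝓝[<] (0 : ℝ), ProbabilityTheory.mgf id ρ s < 1 := by
    have hs := (hasDerivWithinAt_iff_tendsto_slope' (by simp)).1
      (hd.hasDerivWithinAt (s := Set.Iio 0))
    filter_upwards [hs.eventually_const_lt hdrift, self_mem_nhdsWithin] with s hs hs0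
    rw [slope_def_field, ProbabilityTheory.mgf_zero] at hs
    simp only [sub_zero] at hs
    have := (div_pos_iff.1 hs).resolve_left fun h => absurd h.2 (not_lt.2 (le_of_lt hs0))
    linarith [this.1]
  have h2 : ∀ᶠ s in 𝓝[<] (0 : ℝ), s ∈ ProbabilityTheory.integrableExpSet id ρ :=
    nhdsWithin_le_nhds (mem_interior_iff_mem_nhds.1 h0)
  obtain ⟨s, ⟨hs1, hs2⟩, hs0⟩ := ((h1.and h2).and self_mem_nhdsWithin).exists
  refine ⟨-s, neg_pos.2 hs0, ProbabilityTheory.mgf id ρ s, ProbabilityTheory.mgf_pos hs2, hs1, ?_⟩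
  rw [reflected, lintegral_map (by fun_prop) measurable_neg, ProbabilityTheory.mgf,
    ofReal_integral_eq_lintegral_ofReal hs2 (Eventually.of_forall fun _ => Real.exp_nonneg _)]
  simp

/-- The n-th power sits mostly below -δn. Where |x| ≥ δn, the weight (1 + |x|)^(-2) is at most (1 +
δn)^(-2); elsewhere it is at most 1 ≤ e^{t(δn + x)}, whose integral is exponentially small. Both
bounds are summable in n. -/
theorem hasTemperateGrowth_greenKernel {ρ : Measure ℝ} [IsProbabilityMeasure ρ]
    (hexp : HasExponentialMoment ρ) (hdrift : 0 < drift ρ) :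
    (greenKernel ρ).HasTemperateGrowth := by
  obtain ⟨t, ht, q, hq0, hq1, hq⟩ := exists_lintegral_exp_lt_one hexp hdrift
  -- Half of the critical speed -log q / t, so that e^{tδn} q^n = q^{n/2} still decays.
  set δ : ℝ := -Real.log q / (2 * t) with hδ
  have hlog : Real.log q < 0 := Real.log_neg hq0 hq1
  have hδ0 : 0 < δ := div_pos (neg_pos.2 hlog) (by positivity)
  set r : ℝ := Real.exp (Real.log q / 2)
  have hr1 : r < 1 := Real.exp_lt_one_iff.2 (by linarith)
  have hr : ∀ n : ℕ, Real.exp (t * (δ * n)) * q ^ n = r ^ n := fun n => by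
    rw [← Real.exp_nat_mul, ← Real.rpow_natCast q, Real.rpow_def_of_pos hq0, ← Real.exp_add]
    congr 1
    rw [hδ]
    field_simp
    ring
  refine ⟨⟨2, ?_, ?_⟩⟩
  · exact (Measurable.pow_const (by fun_prop) _).aestronglyMeasurable
  have hb : ∀ n : ℕ, ∫⁻ x, ‖(1 + ‖x‖) ^ (-((2 : ℕ) : ℝ))‖ₑ ∂(convPow (reflected ρ) n) ≤
      ENNReal.ofReal ((1 + δ * n) ^ (-(2 : ℝ)) + r ^ n) := by
    intro n
    calc ∫⁻ x, ‖(1 + ‖x‖) ^ (-((2 : ℕ) : ℝ))‖ₑ ∂(convPow (reflected ρ) n)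
        ≤ ∫⁻ x, (ENNReal.ofReal ((1 + δ * n) ^ (-(2 : ℝ))) +
            ENNReal.ofReal (Real.exp (t * (δ * n))) * ENNReal.ofReal (Real.exp (t * x)))
            ∂(convPow (reflected ρ) n) := by
          refine lintegral_mono fun x => ?_
          simp only
          rw [Real.enorm_of_nonneg (by positivity), ← ENNReal.ofReal_mul (Real.exp_nonneg _),
            ← ENNReal.ofReal_add (by positivity) (by positivity), ← Real.exp_add]
          refine ENNReal.ofReal_le_ofReal ?_
          push_cast
          rcases le_total (δ * n) |x| with h | h
          · refine le_add_of_le_of_nonneg ?_ (Real.exp_nonneg _)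
            exact Real.rpow_le_rpow_of_nonpos (by positivity) (by simpa using h) (by norm_num)
          · refine le_add_of_nonneg_of_le (by positivity) ?_
            refine (Real.rpow_le_one_of_one_le_of_nonpos (by simp) (by norm_num)).trans ?_
            refine Real.one_le_exp ?_
            have := neg_le_of_abs_le h
            nlinarith
      _ = ENNReal.ofReal ((1 + δ * n) ^ (-(2 : ℝ)) + r ^ n) := by
          rw [lintegral_add_left measurable_const, lintegral_const, measure_univ, mul_one,
            lintegral_const_mul _ (by fun_prop), lintegral_exp_convPow, hq,
            ← ENNReal.ofReal_pow hq0.le, ← ENNReal.ofReal_mul (Real.exp_nonneg _), hr,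
            ENNReal.ofReal_add (by positivity) (by positivity)]
  have hsum : Summable fun n : ℕ => (1 + δ * n) ^ (-(2 : ℝ)) + r ^ n := by
    refine Summable.add ?_ (summable_geometric_of_lt_one (Real.exp_nonneg _) hr1)
    refine Summable.of_norm_bounded_eventually_nat
      (g := fun n : ℕ => (δ ^ 2)⁻¹ * ((n : ℝ) ^ 2)⁻¹)
      ((Real.summable_nat_pow_inv.2 one_lt_two).mul_left _) ?_
    filter_upwards [eventually_gt_atTop 0] with n hn
    have hn' : (0 : ℝ) < n := by exact_mod_cast hn
    rw [Real.norm_of_nonneg (by positivity), Real.rpow_neg (by positivity), ← mul_inv, ← mul_pow]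
    refine inv_anti₀ (by positivity) ?_
    rw [Real.rpow_two]
    gcongr
    linarith
  rw [HasFiniteIntegral, greenKernel, lintegral_sum_measure]
  refine (ENNReal.tsum_le_tsum hb).trans_lt ?_
  rw [← ENNReal.ofReal_tsum_of_nonneg (fun n => by positivity) hsum]
  exact ENNReal.ofReal_lt_top

instance sFinite_greenKernel (ρ : Measure ℝ) [IsProbabilityMeasure ρ] :
    SFinite (greenKernel ρ) :=
  inferInstanceAs (SFinite (Measure.sum fun n : ℕ => convPow (reflected ρ) n))

/-- The renewal equation: detach the term n = 0 and shift the index in the rest. -/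
theorem greenKernel_eq (ρ : Measure ℝ) [IsProbabilityMeasure ρ] :
    greenKernel ρ = Measure.dirac 0 + (greenKernel ρ).conv (reflected ρ) := by
  have h : (greenKernel ρ).conv (reflected ρ) =
      Measure.sum fun n : ℕ => convPow (reflected ρ) (n + 1) := by
    rw [Measure.conv, greenKernel, Measure.prod_sum_left, Measure.map_sum (by fun_prop)]
    rfl
  rw [h]
  ext s hs
  rw [greenKernel, Measure.sum_apply _ hs, Measure.add_apply, Measure.sum_apply _ hs,
    tsum_eq_zero_add' ENNReal.summable]
  rfl

theorem integral_greenKernel_eq {ρ : Measure ℝ} [IsProbabilityMeasure ρ] {h : ℝ → ℂ}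
    (hc : Continuous h) (hi : Integrable h (greenKernel ρ)) :
    ∫ x, h x ∂(greenKernel ρ) = h 0 + ∫ z, ∫ y, h (y - z) ∂(greenKernel ρ) ∂ρ := by
  have h2 : Integrable h ((greenKernel ρ).conv (reflected ρ)) := by
    rw [greenKernel_eq] at hi
    exact hi.right_of_add_measure
  have h3 : Integrable (fun p : ℝ × ℝ => h (p.1 + p.2)) ((greenKernel ρ).prod (reflected ρ)) :=
    (integrable_map_measure hc.aestronglyMeasurable (by fun_prop)).1 h2
  conv_lhs => rw [greenKernel_eq]
  rw [integral_add_measure (integrable_dirac (by simp)) h2, integral_dirac, Measure.conv,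
    integral_map (by fun_prop) hc.aestronglyMeasurable, integral_prod_symm _ h3, reflected,
    integral_map measurable_neg.aemeasurable]
  · simp [sub_eq_add_neg]
  · exact h3.1.prod_swap.integral_prod_right'

/-! ### The half line -/

theorem hasTemperateGrowth_halfLine (c : ℝ) : (halfLine c).HasTemperateGrowth := by
  obtain ⟨n, hn⟩ := (inferInstance : (volume : Measure ℝ).HasTemperateGrowth).exists_integrable
  exact ⟨⟨n, (hn.restrict).smul_measure ENNReal.ofReal_ne_top⟩⟩

theorem integral_halfLine {c : ℝ} (hc : 0 < c) (f : ℝ → ℂ) :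
    ∫ x, f x ∂(halfLine c) = (c : ℂ)⁻¹ * ∫ x in Set.Iic 0, f x := by
  rw [halfLine, integral_smul_measure, ENNReal.toReal_ofReal (by positivity)]
  simp

/-! ### Fourier transforms -/

theorem integral_angularFourier (μ : Measure ℝ) [IsFiniteMeasure μ] (φ : 𝓢(ℝ, ℂ)) :
    ∫ x, angularFourier φ x ∂μ = ∫ ξ, charFun μ (-ξ) * φ ξ := by
  have hi : Integrable (fun p : ℝ × ℝ => Complex.exp (-(Complex.I * (p.1 : ℂ) * (p.2 : ℂ))) * φ p.2)
      (μ.prod volume) := by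
    have h1 : Integrable (fun p : ℝ × ℝ => φ p.2) (μ.prod volume) :=
      φ.integrable.comp_snd μ
    refine h1.mono (by
      have := φ.continuous
      exact (by fun_prop : Continuous _).aestronglyMeasurable) (Eventually.of_forall fun p => ?_)
    have : -(Complex.I * (p.1 : ℂ) * (p.2 : ℂ)) = ((-(p.1 * p.2) : ℝ) : ℂ) * Complex.I := by
      push_cast
      ring
    rw [norm_mul, this, Complex.norm_exp_ofReal_mul_I, one_mul]
  simp_rw [angularFourier_apply]
  rw [integral_integral_swap hi]
  refine integral_congr_ae (Eventually.of_forall fun ξ => ?_)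
  simp only
  rw [integral_mul_const, charFun_apply_real]
  congr! 4
  push_cast
  ring

theorem angularFourier_surjective : Function.Surjective angularFourier := by
  intro f
  refine ⟨𝓕⁻ (SchwartzMap.compCLMOfContinuousLinearEquiv ℂ dilation.symm f), ?_⟩
  ext x
  simp [angularFourier]

end Renewal

end

noncomputable section

namespace Renewal

/-! ### Taylor remainders of the characteristic function -/

/-- The function `K` with `ρ̂(-iξ) = 1 + iξ λ - ξ² K(ξ)`. -/
def taylorRemainder (ρ : Measure ℝ) (ξ : ℝ) : ℂ :=
  ∫ p : ℝ × ℝ, ((1 - p.2) * p.1 ^ 2 : ℂ) * Complex.exp (ξ * (p.2 * p.1 : ℝ) * Complex.I)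
    ∂(ρ.prod (volume.restrict (Set.Ioc 0 1)))

/-- The function `H` with `1 - ρ̂(-iξ) = -iξ H(ξ)`. -/
def driftQuotient (ρ : Measure ℝ) (ξ : ℝ) : ℂ :=
  drift ρ + Complex.I * ξ * taylorRemainder ρ ξ

section

variable {ρ : Measure ℝ} [IsProbabilityMeasure ρ]

/-- The remainder is an oscillatory integral over pairs (y, t) with phase ty and weight (1 - t)y².
All factors in t have modulus at most 1, so the moment of ρ of order n + 2 dominates. -/
theorem HasExponentialMoment.integrable_mul_pow (hexp : HasExponentialMoment ρ) (n : ℕ) :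
    Integrable (fun p : ℝ × ℝ => ((1 - p.2) * p.1 ^ 2 : ℂ) * ((p.2 * p.1 : ℝ) : ℂ) ^ n)
      (ρ.prod (volume.restrict (Set.Ioc 0 1))) := by
  have h1 : Integrable (fun p : ℝ × ℝ => |p.1| ^ (n + 2))
      (ρ.prod (volume.restrict (Set.Ioc (0 : ℝ) 1))) :=
    (hexp.integrable_pow (n + 2)).comp_fst _
  refine h1.mono (by exact (by fun_prop : Continuous _).aestronglyMeasurable) ?_
  have h2 : ∀ᵐ p : ℝ × ℝ ∂(ρ.prod (volume.restrict (Set.Ioc 0 1))), p.2 ∈ Set.Ioc (0 : ℝ) 1 :=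
    Measure.quasiMeasurePreserving_snd.ae (ae_restrict_mem measurableSet_Ioc)
  filter_upwards [h2] with p hp
  have e1 : ‖(1 - p.2 : ℂ)‖ ≤ 1 := by
    rw [← Complex.ofReal_one, ← Complex.ofReal_sub, Complex.norm_real, Real.norm_eq_abs, abs_le]
    constructor <;> linarith [hp.1, hp.2]
  have e2 : |p.2| ^ n ≤ 1 := pow_le_one₀ (abs_nonneg _) (abs_le.2 ⟨by linarith [hp.1], hp.2⟩)
  simp only [norm_mul, norm_pow, Complex.norm_real, Real.norm_eq_abs, abs_abs, mul_pow]
  calc ‖(1 - p.2 : ℂ)‖ * |p.1| ^ 2 * (|p.2| ^ n * |p.1| ^ n)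
      ≤ 1 * |p.1| ^ 2 * (1 * |p.1| ^ n) := by gcongr
    _ = |p.1| ^ (n + 2) := by ring

theorem hasTemperateGrowth_taylorRemainder (hexp : HasExponentialMoment ρ) :
    (taylorRemainder ρ).HasTemperateGrowth :=
  hasTemperateGrowth_integral_mul_exp
    (by exact (by fun_prop : Continuous _).aestronglyMeasurable) hexp.integrable_mul_pow

theorem hasTemperateGrowth_driftQuotient (hexp : HasExponentialMoment ρ) :
    (driftQuotient ρ).HasTemperateGrowth :=
  (Function.HasTemperateGrowth.const _).add (((Function.HasTemperateGrowth.const _).mul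
    Function.Complex.hasTemperateGrowth_ofReal).mul (hasTemperateGrowth_taylorRemainder hexp))

theorem sq_mul_integral_taylor (x : ℝ) :
    (x : ℂ) ^ 2 * ∫ t : ℝ in (0 : ℝ)..1, (1 - t : ℂ) * Complex.exp (t * x * Complex.I) =
      1 + x * Complex.I - Complex.exp (x * Complex.I) := by
  rw [← intervalIntegral.integral_const_mul]
  -- An explicit primitive, as obtained from integration by parts.
  have hd : ∀ t : ℝ, HasDerivAt
      (fun t : ℝ => -(x * Complex.I) * (1 - t) * Complex.exp (t * x * Complex.I) -
        Complex.exp (t * x * Complex.I))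
      ((x : ℂ) ^ 2 * ((1 - t : ℂ) * Complex.exp (t * x * Complex.I))) t := by
    intro t
    have h0 : HasDerivAt (fun t : ℝ => (t : ℂ)) 1 t := Complex.ofRealCLM.hasDerivAt
    have h1 : HasDerivAt (fun t : ℝ => (t : ℂ) * x * Complex.I) (x * Complex.I) t := by
      simpa using (h0.mul_const (x : ℂ)).mul_const Complex.I
    have h2 := h1.cexp
    have h3 := (((h0.const_sub 1).const_mul (-(x * Complex.I) : ℂ)).mul h2).sub h2
    refine h3.congr_deriv ?_
    linear_combination -((x : ℂ) ^ 2 * (1 - t) * Complex.exp (t * x * Complex.I)) * Complex.I_mul_I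
  rw [intervalIntegral.integral_eq_sub_of_hasDerivAt (fun t _ => hd t)
    (Continuous.intervalIntegrable (by fun_prop) _ _)]
  simp
  ring

theorem HasExponentialMoment.integrable_id (hexp : HasExponentialMoment ρ) :
    Integrable (fun y : ℝ => (y : ℂ)) ρ := by
  refine ((hexp.integrable_pow 1).mono (by exact (by fun_prop : Continuous _).aestronglyMeasurable)
    (Eventually.of_forall fun y => ?_))
  simp

theorem integrable_exp_mul_I (ξ : ℝ) :
    Integrable (fun y : ℝ => Complex.exp (ξ * y * Complex.I)) ρ := by
  refine Integrable.of_bound (by exact (by fun_prop : Continuous _).aestronglyMeasurable) 1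
    (Eventually.of_forall fun y => ?_)
  rw [← Complex.ofReal_mul, Complex.norm_exp_ofReal_mul_I]

theorem sq_mul_taylorRemainder (hexp : HasExponentialMoment ρ) (ξ : ℝ) :
    (ξ : ℂ) ^ 2 * taylorRemainder ρ ξ = 1 + Complex.I * ξ * drift ρ - charFun ρ ξ := by
  have hi : Integrable (fun p : ℝ × ℝ => ((1 - p.2) * p.1 ^ 2 : ℂ) *
      Complex.exp (ξ * (p.2 * p.1 : ℝ) * Complex.I))
      (ρ.prod (volume.restrict (Set.Ioc 0 1))) := by
    refine (hexp.integrable_mul_pow 0).mono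
      (by exact (by fun_prop : Continuous _).aestronglyMeasurable) (Eventually.of_forall fun p => ?_)
    rw [norm_mul, ← Complex.ofReal_mul, Complex.norm_exp_ofReal_mul_I, pow_zero, mul_one, mul_one]
  rw [taylorRemainder, integral_prod _ hi, ← integral_const_mul]
  have h1 : ∀ y : ℝ, (ξ : ℂ) ^ 2 * ∫ t : ℝ in Set.Ioc (0 : ℝ) 1, ((1 - t) * y ^ 2 : ℂ) *
      Complex.exp (ξ * (t * y : ℝ) * Complex.I) =
      1 + Complex.I * ξ * y - Complex.exp (ξ * y * Complex.I) := by
    intro y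
    have h := sq_mul_integral_taylor (ξ * y)
    rw [← intervalIntegral.integral_of_le zero_le_one]
    have h' : ∫ t : ℝ in (0 : ℝ)..1, ((1 - t) * y ^ 2 : ℂ) *
        Complex.exp (ξ * (t * y : ℝ) * Complex.I) = (y : ℂ) ^ 2 *
        ∫ t : ℝ in (0 : ℝ)..1, (1 - t : ℂ) * Complex.exp (t * (ξ * y : ℝ) * Complex.I) := by
      rw [← intervalIntegral.integral_const_mul]
      refine intervalIntegral.integral_congr fun t _ => ?_
      have : (ξ : ℂ) * ((t * y : ℝ) : ℂ) * Complex.I = t * (ξ * y : ℝ) * Complex.I := by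
        push_cast
        ring
      simp only [this]
      ring
    rw [h', ← mul_assoc, ← mul_pow, ← Complex.ofReal_mul, h]
    push_cast
    ring
  simp_rw [h1]
  have h2 : Integrable (fun y : ℝ => 1 + Complex.I * ξ * (y : ℂ)) ρ :=
    (integrable_const _).add (hexp.integrable_id.const_mul _)
  rw [integral_sub h2 (integrable_exp_mul_I ξ), integral_add (integrable_const _) (hexp.integrable_id.const_mul _),
    integral_const_mul, charFun_apply_real, drift, integral_complex_ofReal]
  simp

theorem one_sub_charFun_eq (hexp : HasExponentialMoment ρ) (ξ : ℝ) :
    1 - charFun ρ ξ = -(Complex.I * ξ) * driftQuotient ρ ξ := by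
  rw [driftQuotient]
  linear_combination -sq_mul_taylorRemainder hexp ξ +
    (ξ : ℂ) ^ 2 * taylorRemainder ρ ξ * Complex.I_mul_I

theorem norm_one_sub_charFun_eq (hexp : HasExponentialMoment ρ) (ξ : ℝ) :
    ‖1 - charFun ρ ξ‖ = |ξ| * ‖driftQuotient ρ ξ‖ := by
  simp [one_sub_charFun_eq hexp]

/-! ### The diophantine condition -/

/-- The exponent l may be rounded up to an integer once |b| ≥ 1, which is why the radius is taken at
least 1. -/
theorem isWeaklyDiophantine_iff {ρ : Measure ℝ} :
    IsWeaklyDiophantine ρ ↔ ∃ (N : ℕ) (c : ℝ) (R : ℝ), 0 < c ∧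
      ∀ b : ℝ, R ≤ |b| → c ≤ |b| ^ N * ‖1 - charFun ρ b‖ := by
  constructor
  · rintro ⟨l, hl, h⟩
    rw [IsWeaklyDiophantineOfOrder] at h
    obtain ⟨c, hc, hcl⟩ := EReal.lt_iff_exists_real_btwn.1 h
    have hev := eventually_lt_of_lt_liminf hcl
    obtain ⟨h1, h2⟩ := eventually_sup.1 hev
    obtain ⟨a, ha⟩ := eventually_atBot.1 h1
    obtain ⟨a', ha'⟩ := eventually_atTop.1 h2
    refine ⟨⌈l⌉₊, c, max 1 (max (-a) a'), EReal.coe_pos.1 hc, fun b hb => ?_⟩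
    have hb1 : 1 ≤ |b| := (le_max_left _ _).trans hb
    have hb2 : -a ≤ |b| := ((le_max_left _ _).trans (le_max_right _ _)).trans hb
    have hb3 : a' ≤ |b| := ((le_max_right _ _).trans (le_max_right _ _)).trans hb
    have hlt : c < |b| ^ l * ‖1 - charFun ρ b‖ := by
      rw [← norm_one_sub_laplace_I_mul]
      rcases le_total 0 b with h0 | h0
      · rw [abs_of_nonneg h0] at hb3
        exact EReal.coe_lt_coe_iff.1 (ha' b hb3)
      · rw [abs_of_nonpos h0] at hb2
        exact EReal.coe_lt_coe_iff.1 (ha b (by linarith))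
    refine hlt.le.trans ?_
    gcongr
    rw [← Real.rpow_natCast]
    exact Real.rpow_le_rpow_of_exponent_le hb1 (Nat.le_ceil l)
  · rintro ⟨N, c, R, hc, h⟩
    refine ⟨N, N.cast_nonneg, ?_⟩
    rw [IsWeaklyDiophantineOfOrder]
    refine (EReal.coe_pos.2 hc).trans_le (le_liminf_of_le (by isBoundedDefault) ?_)
    have key : ∀ b : ℝ, R ≤ |b| → (c : EReal) ≤
        ((|b| ^ (N : ℝ) * ‖1 - laplace ρ (Complex.I * (b : ℂ))‖ : ℝ) : EReal) := fun b hb => by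
      rw [norm_one_sub_laplace_I_mul, Real.rpow_natCast]
      exact EReal.coe_le_coe_iff.2 (h b hb)
    refine eventually_sup.2 ⟨?_, ?_⟩
    · filter_upwards [eventually_le_atBot (-R)] with b hb
      exact key b (by linarith [neg_abs_le b])
    · filter_upwards [eventually_ge_atTop R] with b hb
      exact key b (hb.trans (le_abs_self b))

/-- The nonnegative function 1 - cos(ξy) has integral 0, so e^{iξy} = 1 for ρ-almost every y, and
this passes to n-th powers. -/
theorem charFun_nat_mul_eq_one {ξ : ℝ} (h : charFun ρ ξ = 1) (n : ℕ) :
    charFun ρ (n * ξ) = 1 := by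
  have hn : ∀ y : ℝ, ‖Complex.exp (ξ * y * Complex.I)‖ = 1 := fun y => by
    rw [← Complex.ofReal_mul, Complex.norm_exp_ofReal_mul_I]
  have h1 : ∫ y : ℝ, (1 - Complex.exp (ξ * y * Complex.I)).re ∂ρ = 0 := by
    have hi : Integrable (fun y : ℝ => 1 - Complex.exp (ξ * y * Complex.I)) ρ :=
      (integrable_const _).sub (integrable_exp_mul_I ξ)
    have := integral_re hi
    simp only [RCLike.re_to_complex] at this
    rw [this, integral_sub (integrable_const _) (integrable_exp_mul_I ξ), ← charFun_apply_real, h]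
    simp
  have h0 : ∀ y : ℝ, 0 ≤ (1 - Complex.exp (ξ * y * Complex.I)).re := fun y => by
    have := Complex.re_le_norm (Complex.exp (ξ * y * Complex.I))
    rw [hn] at this
    simpa using this
  rw [integral_eq_zero_iff_of_nonneg h0
    (((integrable_const _).sub (integrable_exp_mul_I ξ)).re)] at h1
  rw [charFun_apply_real]
  have h2 : (fun y : ℝ => Complex.exp ((n * ξ : ℝ) * y * Complex.I)) =ᵐ[ρ] fun _ => 1 := by
    filter_upwards [h1] with y hy
    have hre : (Complex.exp (ξ * y * Complex.I)).re = 1 := by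
      simp only [Pi.zero_apply, Complex.sub_re, Complex.one_re] at hy
      linarith
    have him : (Complex.exp (ξ * y * Complex.I)).im = 0 := by
      have := Complex.sq_norm (Complex.exp (ξ * y * Complex.I))
      rw [hn, Complex.normSq_apply, hre] at this
      nlinarith
    have : Complex.exp (ξ * y * Complex.I) = 1 := Complex.ext hre him
    have e : ((n * ξ : ℝ) : ℂ) * y * Complex.I = n * (ξ * y * Complex.I) := by
      push_cast
      ring
    rw [e, Complex.exp_nat_mul, this, one_pow]
  rw [integral_congr_ae h2]
  simp

theorem IsWeaklyDiophantine.charFun_ne_one (hρ : IsWeaklyDiophantine ρ) {ξ : ℝ} (hξ : ξ ≠ 0) :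
    charFun ρ ξ ≠ 1 := by
  intro h
  obtain ⟨N, c, R, hc, hb⟩ := isWeaklyDiophantine_iff.1 hρ
  obtain ⟨n, hn⟩ := exists_nat_gt (R / |ξ|)
  have := hb (n * ξ) (by
    rw [abs_mul, Nat.abs_cast]
    exact ((div_lt_iff₀ (abs_pos.2 hξ)).1 hn).le)
  rw [charFun_nat_mul_eq_one h n] at this
  simp at this
  linarith

theorem IsWeaklyDiophantine.driftQuotient_ne_zero (hρ : IsWeaklyDiophantine ρ)
    (hexp : HasExponentialMoment ρ) (hdrift : 0 < drift ρ) (ξ : ℝ) : driftQuotient ρ ξ ≠ 0 := by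
  intro h
  rcases eq_or_ne ξ 0 with rfl | hξ
  · simp [driftQuotient, hdrift.ne'] at h
  · refine hρ.charFun_ne_one hξ (sub_eq_zero.1 ?_).symm
    rw [one_sub_charFun_eq hexp, h, mul_zero]

/-- Compactness and the absence of zeros handle |ξ| ≤ |R|; beyond, the diophantine bound applies,
the exponent N + 1 accounting for the factor |ξ| in |1 - P| = |ξ||H|. -/
theorem IsWeaklyDiophantine.exists_le_norm_driftQuotient (hρ : IsWeaklyDiophantine ρ)
    (hexp : HasExponentialMoment ρ) (hdrift : 0 < drift ρ) :
    ∃ (c : ℝ) (m : ℕ), 0 < c ∧ ∀ ξ, c ≤ ‖driftQuotient ρ ξ‖ * (1 + ‖ξ‖) ^ m := by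
  obtain ⟨N, c, R, hc, hb⟩ := isWeaklyDiophantine_iff.1 hρ
  have hcont : Continuous fun ξ => ‖driftQuotient ρ ξ‖ :=
    (hasTemperateGrowth_driftQuotient hexp).1.continuous.norm
  obtain ⟨x, -, hx⟩ := (isCompact_closedBall (0 : ℝ) |R|).exists_isMinOn
    ⟨0, by simp⟩ hcont.continuousOn
  refine ⟨min c ‖driftQuotient ρ x‖, N + 1,
    lt_min hc (norm_pos_iff.2 (hρ.driftQuotient_ne_zero hexp hdrift x)), fun ξ => ?_⟩
  rcases le_total |ξ| |R| with h | h
  · have h1 : ‖driftQuotient ρ x‖ ≤ ‖driftQuotient ρ ξ‖ := hx (by simpa using h)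
    refine (min_le_right _ _).trans (h1.trans (le_mul_of_one_le_right (norm_nonneg _) ?_))
    exact one_le_pow₀ (by simp)
  · have h1 := hb ξ ((le_abs_self R).trans h)
    refine (min_le_left _ _).trans (h1.trans ?_)
    rw [norm_one_sub_charFun_eq hexp, ← mul_assoc, ← pow_succ, mul_comm]
    gcongr
    simp

end

end Renewal

end

noncomputable section

namespace Renewal

/-! ### The Fourier transform of the renewal distribution -/

section

variable {ρ : Measure ℝ} [IsProbabilityMeasure ρ]

/-- The smooth extension of `ξ ↦ 1 / (1 - ρ̂(-iξ)) + 1 / (iλξ)`. -/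
def renewalSymbol (ρ : Measure ℝ) (ξ : ℝ) : ℂ :=
  taylorRemainder ρ ξ * ((drift ρ : ℂ)⁻¹ * (driftQuotient ρ ξ)⁻¹)

theorem IsWeaklyDiophantine.hasTemperateGrowth_renewalSymbol (hρ : IsWeaklyDiophantine ρ)
    (hexp : HasExponentialMoment ρ) (hdrift : 0 < drift ρ) :
    (renewalSymbol ρ).HasTemperateGrowth := by
  obtain ⟨c, m, hc, h⟩ := hρ.exists_le_norm_driftQuotient hexp hdrift
  exact (hasTemperateGrowth_taylorRemainder hexp).mul ((Function.HasTemperateGrowth.const _).mul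
    ((hasTemperateGrowth_driftQuotient hexp).inv_of_le hc h))

theorem IsWeaklyDiophantine.renewalSymbol_eq (hρ : IsWeaklyDiophantine ρ)
    (hexp : HasExponentialMoment ρ) (hdrift : 0 < drift ρ) {ξ : ℝ} (hξ : ξ ≠ 0) :
    renewalSymbol ρ ξ =
      1 / (1 - charFun ρ ξ) + 1 / ((drift ρ : ℂ) * (Complex.I * (ξ : ℂ))) := by
  have hH := hρ.driftQuotient_ne_zero hexp hdrift ξ
  have hξ' : (ξ : ℂ) ≠ 0 := by exact_mod_cast hξ
  have hd : (drift ρ : ℂ) ≠ 0 := by exact_mod_cast hdrift.ne'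
  have hI := Complex.I_ne_zero
  have hK : Complex.I * ξ * taylorRemainder ρ ξ = driftQuotient ρ ξ - drift ρ := by
    rw [driftQuotient]
    ring
  rw [one_sub_charFun_eq hexp, renewalSymbol]
  field_simp
  linear_combination hK

theorem summable_norm_integral_convPow {ρ : Measure ℝ} {f : ℝ → ℂ} (hf : Integrable f (greenKernel ρ)) :
    Summable fun n : ℕ => ‖∫ x, f x ∂(convPow (reflected ρ) n)‖ :=
  (integrable_sum_measure_iff.1 hf).2.of_nonneg_of_le (fun _ => norm_nonneg _)
    fun _ => norm_integral_le_integral_norm _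

theorem integral_angularFourier_convPow (φ : 𝓢(ℝ, ℂ)) (n : ℕ) :
    ∫ x, angularFourier φ x ∂(convPow (reflected ρ) n) = ∫ ξ, charFun ρ ξ ^ n * φ ξ := by
  simp_rw [integral_angularFourier, charFun_convPow, charFun_reflected, neg_neg]

theorem norm_mul_charFun_lt_one {s : ℝ} (hs0 : 0 ≤ s) (hs1 : s < 1) (ξ : ℝ) :
    ‖(s : ℂ) * charFun ρ ξ‖ < 1 := by
  rw [norm_mul, Complex.norm_real, Real.norm_of_nonneg hs0]
  exact (mul_le_of_le_one_right hs0 (norm_charFun_le_one ξ)).trans_lt hs1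

/-- For s < 1 the geometric series converges absolutely and uniformly in ξ, so sum and integral may
be exchanged; at s = 1 this breaks down at ξ = 0. -/
theorem tsum_pow_mul_integral_convPow (φ : 𝓢(ℝ, ℂ)) {s : ℝ} (hs0 : 0 ≤ s) (hs1 : s < 1) :
    ∑' n : ℕ, (s : ℂ) ^ n * ∫ x, angularFourier φ x ∂(convPow (reflected ρ) n) =
      ∫ ξ, (1 - s * charFun ρ ξ)⁻¹ * φ ξ := by
  have hm : AEStronglyMeasurable (charFun ρ) := measurable_charFun.aestronglyMeasurable
  have hle : ∀ (n : ℕ) ξ, ‖(s * charFun ρ ξ) ^ n * φ ξ‖ ≤ s ^ n * ‖φ ξ‖ := fun n ξ => by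
    rw [norm_mul, norm_pow, norm_mul, Complex.norm_real, Real.norm_of_nonneg hs0]
    gcongr
    exact mul_le_of_le_one_right hs0 (norm_charFun_le_one ξ)
  have hi : ∀ n : ℕ, Integrable fun ξ => (s * charFun ρ ξ) ^ n * φ ξ := fun n =>
    (φ.integrable.norm.const_mul (s ^ n)).mono' (((hm.const_mul _).pow n).mul φ.integrable.1)
      (Eventually.of_forall (hle n))
  have hs := hasSum_integral_of_summable_integral_norm hi (by
    refine Summable.of_nonneg_of_le (fun n => integral_nonneg fun _ => norm_nonneg _)
      (fun n => integral_mono (hi n).norm (φ.integrable.norm.const_mul (s ^ n)) (hle n)) ?_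
    simp_rw [integral_const_mul]
    exact (summable_geometric_of_lt_one hs0 hs1).mul_right _)
  have h2 : ∀ n : ℕ, ∫ ξ, (s * charFun ρ ξ) ^ n * φ ξ =
      (s : ℂ) ^ n * ∫ x, angularFourier φ x ∂(convPow (reflected ρ) n) := fun n => by
    rw [integral_angularFourier_convPow, ← integral_const_mul]
    simp_rw [mul_pow, mul_assoc]
  simp_rw [h2] at hs
  rw [hs.tsum_eq]
  refine integral_congr_ae (Eventually.of_forall fun ξ => ?_)
  simp only
  rw [tsum_mul_right, tsum_geometric_of_norm_lt_one (norm_mul_charFun_lt_one hs0 hs1 ξ)]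

theorem integral_Iic_exp_mul_angularFourier (φ : 𝓢(ℝ, ℂ)) {ε : ℝ} (hε : 0 < ε) :
    ∫ x : ℝ in Set.Iic 0, Complex.exp (ε * x) * angularFourier φ x =
      ∫ ξ : ℝ, (ε - Complex.I * ξ)⁻¹ * φ ξ := by
  have hi : Integrable (fun p : ℝ × ℝ => Complex.exp (ε * p.1) *
      (Complex.exp (-(Complex.I * (p.1 : ℂ) * (p.2 : ℂ))) * φ p.2))
      ((volume.restrict (Set.Iic 0)).prod volume) := by
    have h1 : Integrable (fun p : ℝ × ℝ => Complex.exp (ε * p.1) * φ p.2)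
        ((volume.restrict (Set.Iic 0)).prod volume) :=
      (integrableOn_exp_mul_complex_Iic (a := ε) (by simpa using hε) 0).mul_prod φ.integrable
    refine h1.mono (by
      have := φ.continuous
      exact (by fun_prop : Continuous _).aestronglyMeasurable) (Eventually.of_forall fun p => ?_)
    have : -(Complex.I * (p.1 : ℂ) * (p.2 : ℂ)) = ((-(p.1 * p.2) : ℝ) : ℂ) * Complex.I := by
      push_cast
      ring
    rw [norm_mul, norm_mul, this, Complex.norm_exp_ofReal_mul_I, one_mul, norm_mul]
  simp_rw [angularFourier_apply, ← integral_const_mul]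
  rw [integral_integral_swap hi]
  refine integral_congr_ae (Eventually.of_forall fun ξ => ?_)
  simp_rw [← mul_assoc, ← Complex.exp_add]
  rw [integral_mul_const]
  have h := integral_exp_mul_complex_Iic (a := ε - Complex.I * ξ) (by simpa using hε) 0
  rw [Complex.ofReal_zero, mul_zero, Complex.exp_zero, one_div] at h
  rw [← h]
  congr! 4
  ring

/-- The Abel regularisation of the Fourier transform of `G - T_λ`. -/
def abelSymbol (ρ : Measure ℝ) (ε ξ : ℝ) : ℂ :=
  (1 - (1 - drift ρ * ε : ℝ) * charFun ρ ξ)⁻¹ - ((drift ρ : ℂ) * (ε - Complex.I * ξ))⁻¹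

theorem measurable_abelSymbol (ε : ℝ) : Measurable (abelSymbol ρ ε) := by
  have : Measurable (charFun ρ) := measurable_charFun
  unfold abelSymbol
  fun_prop

/-- The two dampings are matched: with s = 1 - λε the first-order terms cancel in the difference of
the denominators, N₂ - N₁ = -ξ²K + λε(1 - P). The bounds |1 - P| ≤ 2|N₁|, λ|ξ| ≤ |N₂| and λε ≤ |N₂|,
with |ξ²K| = |U| λ|ξ||1 - P|, make the quotient bounded independently of ε. -/
theorem IsWeaklyDiophantine.norm_abelSymbol_le (hρ : IsWeaklyDiophantine ρ)
    (hexp : HasExponentialMoment ρ) (hdrift : 0 < drift ρ) {ε : ℝ} (hε : 0 < ε)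
    (hε1 : drift ρ * ε < 1) {ξ : ℝ} (hξ : ξ ≠ 0) :
    ‖abelSymbol ρ ε ξ‖ ≤ 2 + 2 * ‖renewalSymbol ρ ξ‖ := by
  set s : ℝ := 1 - drift ρ * ε with hs
  set N₁ : ℂ := 1 - (s : ℂ) * charFun ρ ξ with hN₁
  set N₂ : ℂ := (drift ρ : ℂ) * (ε - Complex.I * ξ) with hN₂
  have hd : 0 < drift ρ * ε := mul_pos hdrift hε
  have hP := norm_charFun_le_one (μ := ρ) ξ
  have hsP : 1 - s ≤ ‖N₁‖ := by
    have h1 := norm_sub_norm_le (1 : ℂ) ((s : ℂ) * charFun ρ ξ)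
    rw [norm_one, norm_mul, Complex.norm_real, Real.norm_of_nonneg (by linarith : 0 ≤ s)] at h1
    have : s * ‖charFun ρ ξ‖ ≤ s := mul_le_of_le_one_right (by linarith) hP
    linarith
  have hN₁0 : N₁ ≠ 0 := norm_pos_iff.1 (by linarith)
  have h2N₁ : ‖1 - charFun ρ ξ‖ ≤ 2 * ‖N₁‖ := by
    have e : 1 - charFun ρ ξ = N₁ - ((1 - s : ℝ) : ℂ) * charFun ρ ξ := by
      rw [hN₁]
      push_cast
      ring
    have h1 := norm_sub_le N₁ (((1 - s : ℝ) : ℂ) * charFun ρ ξ)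
    rw [← e, norm_mul, Complex.norm_real, Real.norm_of_nonneg (by linarith)] at h1
    have : (1 - s) * ‖charFun ρ ξ‖ ≤ 1 - s := mul_le_of_le_one_right (by linarith) hP
    linarith
  have hN₂ε : drift ρ * ε ≤ ‖N₂‖ := by
    refine le_trans (le_of_eq ?_) (Complex.re_le_norm N₂)
    simp [hN₂]
  have hN₂ξ : drift ρ * |ξ| ≤ ‖N₂‖ := by
    refine le_trans (le_of_eq ?_) (Complex.abs_im_le_norm N₂)
    simp [hN₂, abs_mul, abs_of_pos hdrift]
  have hN₂0 : N₂ ≠ 0 := norm_pos_iff.1 (by linarith)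
  have hdiff : N₂ - N₁ = -((ξ : ℂ) ^ 2 * taylorRemainder ρ ξ) +
      (drift ρ * ε : ℝ) * (1 - charFun ρ ξ) := by
    rw [sq_mul_taylorRemainder hexp, hN₁, hN₂, hs]
    push_cast
    ring
  have hK : ‖(ξ : ℂ) ^ 2 * taylorRemainder ρ ξ‖ =
      ‖renewalSymbol ρ ξ‖ * (drift ρ * |ξ| * ‖1 - charFun ρ ξ‖) := by
    have hH := norm_ne_zero_iff.2 (hρ.driftQuotient_ne_zero hexp hdrift ξ)
    rw [norm_one_sub_charFun_eq hexp, renewalSymbol]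
    simp only [norm_mul, norm_pow, norm_inv, Complex.norm_real, Real.norm_eq_abs,
      abs_of_pos hdrift]
    have := hdrift.ne'
    field_simp
  have hmain : ‖N₂ - N₁‖ ≤ (2 + 2 * ‖renewalSymbol ρ ξ‖) * (‖N₁‖ * ‖N₂‖) := by
    rw [hdiff]
    refine (norm_add_le _ _).trans ?_
    rw [norm_neg, hK, norm_mul, Complex.norm_real, Real.norm_of_nonneg hd.le]
    have h1 : drift ρ * |ξ| * ‖1 - charFun ρ ξ‖ ≤ ‖N₂‖ * (2 * ‖N₁‖) := by gcongr
    have h2 : drift ρ * ε * ‖1 - charFun ρ ξ‖ ≤ ‖N₂‖ * (2 * ‖N₁‖) := by gcongr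
    calc _ ≤ ‖renewalSymbol ρ ξ‖ * (‖N₂‖ * (2 * ‖N₁‖)) + ‖N₂‖ * (2 * ‖N₁‖) := by gcongr
      _ = _ := by ring
  have : abelSymbol ρ ε ξ = (N₂ - N₁) / (N₁ * N₂) := by
    rw [abelSymbol, inv_sub_inv hN₁0 hN₂0]
  rw [this, norm_div, norm_mul, div_le_iff₀ (by positivity)]
  exact hmain

theorem IsWeaklyDiophantine.tendsto_abelSymbol (hρ : IsWeaklyDiophantine ρ)
    (hexp : HasExponentialMoment ρ) (hdrift : 0 < drift ρ) {ξ : ℝ} (hξ : ξ ≠ 0) :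
    Tendsto (fun ε : ℝ => abelSymbol ρ ε ξ) (𝓝[>] 0) (𝓝 (renewalSymbol ρ ξ)) := by
  have h1 : Continuous fun ε : ℝ => 1 - ((1 - drift ρ * ε : ℝ) : ℂ) * charFun ρ ξ := by fun_prop
  have h2 : Continuous fun ε : ℝ => (drift ρ : ℂ) * (ε - Complex.I * ξ) := by fun_prop
  have hξ' : (ξ : ℂ) ≠ 0 := by exact_mod_cast hξ
  have hd : (drift ρ : ℂ) ≠ 0 := by exact_mod_cast hdrift.ne'
  have h := ((h1.tendsto 0).inv₀ (by simpa [sub_eq_zero] using (hρ.charFun_ne_one hξ).symm)).sub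
    ((h2.tendsto 0).inv₀ (by simp [hξ, hd]))
  refine (h.mono_left nhdsWithin_le_nhds).congr' (Eventually.of_forall fun _ => rfl) |>.trans_eq ?_
  rw [hρ.renewalSymbol_eq hexp hdrift hξ]
  congr 1
  simp only [mul_zero, sub_zero, Complex.ofReal_one, one_mul, Complex.ofReal_zero, zero_sub,
    mul_neg, inv_neg, sub_neg_eq_add, one_div]

theorem IsWeaklyDiophantine.hasFourierTransform (hρ : IsWeaklyDiophantine ρ)
    (hexp : HasExponentialMoment ρ) (hdrift : 0 < drift ρ) {D : 𝓢'(ℝ, ℂ)}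
    (hD : IsDifference D (greenKernel ρ) (halfLine (drift ρ))) :
    HasFourierTransform D (renewalSymbol ρ) := by
  intro φ
  have hUt := hρ.hasTemperateGrowth_renewalSymbol hexp hdrift
  have hU : Integrable fun ξ => renewalSymbol ρ ξ * φ ξ := by
    have := (SchwartzMap.smulLeftCLM ℂ (renewalSymbol ρ) φ).integrable (μ := volume)
    simpa only [SchwartzMap.smulLeftCLM_apply hUt, smul_eq_mul] using this
  refine ⟨hU, ?_⟩
  obtain ⟨hG, hT, hDφ⟩ := hD (angularFourier φ)
  have hd : (drift ρ : ℂ) ≠ 0 := by exact_mod_cast hdrift.ne'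
  have hsmall : ∀ᶠ ε : ℝ in 𝓝[>] 0, 0 < ε ∧ drift ρ * ε < 1 := by
    refine (eventually_mem_nhdsWithin).and (nhdsWithin_le_nhds ?_)
    exact (continuous_const.mul continuous_id).tendsto' 0 0 (by simp) |>.eventually_lt_const
      one_pos
  have hne : ∀ᵐ ξ : ℝ, ξ ≠ 0 := Measure.ae_ne volume 0
  -- Abel's theorem by dominated convergence over n: integrability against G makes the undamped
  -- series absolutely convergent.
  have h1 : Tendsto (fun ε : ℝ => ∑' n : ℕ, ((1 - drift ρ * ε : ℝ) : ℂ) ^ n *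
      ∫ x, angularFourier φ x ∂(convPow (reflected ρ) n)) (𝓝[>] 0)
      (𝓝 (∫ x, angularFourier φ x ∂(greenKernel ρ))) := by
    have e : ∫ x, angularFourier φ x ∂(greenKernel ρ) =
        ∑' n : ℕ, ∫ x, angularFourier φ x ∂(convPow (reflected ρ) n) := integral_sum_measure hG
    rw [e]
    refine tendsto_tsum_of_dominated_convergence (summable_norm_integral_convPow hG)
      (fun n => ?_) ?_
    · refine Tendsto.mono_left ?_ nhdsWithin_le_nhds
      exact Continuous.tendsto' (by fun_prop) _ _ (by simp)
    · filter_upwards [hsmall] with ε hε n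
      rw [norm_mul, norm_pow, Complex.norm_real]
      refine mul_le_of_le_one_left (norm_nonneg _) (pow_le_one₀ (norm_nonneg _) ?_)
      have := mul_pos hdrift hε.1
      rw [Real.norm_eq_abs, abs_le]
      constructor <;> linarith [hε.2]
  have h2 : Tendsto (fun ε : ℝ => (drift ρ : ℂ)⁻¹ * ∫ x : ℝ in Set.Iic 0,
      Complex.exp (ε * x) * angularFourier φ x) (𝓝[>] 0)
      (𝓝 (∫ x, angularFourier φ x ∂(halfLine (drift ρ)))) := by
    rw [integral_halfLine hdrift]
    refine Tendsto.const_mul _ (tendsto_integral_filter_of_dominated_convergence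
      (fun x => ‖angularFourier φ x‖) (Eventually.of_forall fun ε => ?_) ?_
      (angularFourier φ).integrable.norm.restrict (Eventually.of_forall fun x => ?_))
    · have := (angularFourier φ).continuous
      exact (by fun_prop : Continuous _).aestronglyMeasurable
    · filter_upwards [hsmall] with ε hε
      filter_upwards [ae_restrict_mem measurableSet_Iic] with x hx
      rw [norm_mul]
      refine mul_le_of_le_one_left (norm_nonneg _) ?_
      rw [Complex.norm_exp, ← Complex.ofReal_mul, Complex.ofReal_re]
      exact Real.exp_le_one_iff.2 (mul_nonpos_of_nonneg_of_nonpos hε.1.le hx)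
    · refine Tendsto.mono_left ?_ nhdsWithin_le_nhds
      exact Continuous.tendsto' (by fun_prop) _ _ (by simp)
  have hbound : ∀ᶠ ε : ℝ in 𝓝[>] 0, ∀ᵐ ξ : ℝ, ‖abelSymbol ρ ε ξ * φ ξ‖ ≤
      2 * ‖φ ξ‖ + 2 * ‖renewalSymbol ρ ξ * φ ξ‖ := by
    filter_upwards [hsmall] with ε hε
    filter_upwards [hne] with ξ hξ
    have := mul_le_mul_of_nonneg_right
      (hρ.norm_abelSymbol_le hexp hdrift hε.1 hε.2 hξ) (norm_nonneg (φ ξ))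
    rw [norm_mul, norm_mul]
    linarith
  have h3 : Tendsto (fun ε : ℝ => ∫ ξ, abelSymbol ρ ε ξ * φ ξ) (𝓝[>] 0)
      (𝓝 (∫ ξ, renewalSymbol ρ ξ * φ ξ)) := by
    refine tendsto_integral_filter_of_dominated_convergence
      (fun ξ => 2 * ‖φ ξ‖ + 2 * ‖renewalSymbol ρ ξ * φ ξ‖) (Eventually.of_forall fun ε =>
        (measurable_abelSymbol ε).aestronglyMeasurable.mul φ.integrable.1) hbound
      ((φ.integrable.norm.const_mul 2).add (hU.norm.const_mul 2)) ?_
    filter_upwards [hne] with ξ hξ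
    exact (hρ.tendsto_abelSymbol hexp hdrift hξ).mul_const _
  have h4 : ∀ᶠ ε : ℝ in 𝓝[>] 0, ∑' n : ℕ, ((1 - drift ρ * ε : ℝ) : ℂ) ^ n *
      ∫ x, angularFourier φ x ∂(convPow (reflected ρ) n) - (drift ρ : ℂ)⁻¹ *
      ∫ x : ℝ in Set.Iic 0, Complex.exp (ε * x) * angularFourier φ x =
      ∫ ξ, abelSymbol ρ ε ξ * φ ξ := by
    filter_upwards [hsmall] with ε hε
    have hs0 : 0 ≤ 1 - drift ρ * ε := by linarith [hε.2]
    have hs1 : 1 - drift ρ * ε < 1 := by linarith [mul_pos hdrift hε.1]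
    have hm : Measurable (charFun ρ) := measurable_charFun
    have hi2 : Integrable fun ξ : ℝ => (ε - Complex.I * ξ)⁻¹ * φ ξ := by
      refine (φ.integrable.norm.const_mul ε⁻¹).mono'
        ((by fun_prop : Measurable fun ξ : ℝ => (ε - Complex.I * ξ : ℂ)⁻¹).aestronglyMeasurable.mul
          φ.integrable.1) (Eventually.of_forall fun ξ => ?_)
      rw [norm_mul, norm_inv]
      gcongr
      · exact hε.1
      · refine le_trans (le_of_eq ?_) (Complex.re_le_norm _)
        simp
    have hi1 : Integrable fun ξ : ℝ =>
        (1 - ((1 - drift ρ * ε : ℝ) : ℂ) * charFun ρ ξ)⁻¹ * φ ξ := by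
      refine (φ.integrable.norm.const_mul (drift ρ * ε)⁻¹).mono'
        ((by fun_prop : Measurable fun ξ : ℝ =>
          (1 - ((1 - drift ρ * ε : ℝ) : ℂ) * charFun ρ ξ)⁻¹).aestronglyMeasurable.mul
          φ.integrable.1) (Eventually.of_forall fun ξ => ?_)
      rw [norm_mul, norm_inv]
      gcongr
      · exact mul_pos hdrift hε.1
      · have h1 := norm_sub_norm_le (1 : ℂ) (((1 - drift ρ * ε : ℝ) : ℂ) * charFun ρ ξ)
        rw [norm_one, norm_mul, Complex.norm_real, Real.norm_of_nonneg hs0] at h1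
        have := mul_le_of_le_one_right hs0 (norm_charFun_le_one (μ := ρ) ξ)
        linarith
    rw [tsum_pow_mul_integral_convPow φ hs0 hs1, integral_Iic_exp_mul_angularFourier φ hε.1,
      ← integral_const_mul, ← integral_sub hi1 (hi2.const_mul _)]
    refine integral_congr_ae (Eventually.of_forall fun ξ => ?_)
    simp only [abelSymbol, mul_inv]
    ring
  rw [hDφ]
  exact tendsto_nhds_unique ((h1.sub h2).congr' h4) h3

end

end Renewal

end

noncomputable section

namespace Renewal

/-! ### Fast decrease -/

theorem hasTemperateGrowth_exp_mul_I (x : ℝ) :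
    (fun ξ : ℝ => Complex.exp (ξ * x * Complex.I)).HasTemperateGrowth := by
  -- A single exponential is an oscillatory integral over a one-point space.
  have := hasTemperateGrowth_integral_mul_exp (μ := Measure.dirac ()) (X := fun _ => x)
    (W := fun _ => 1) (by fun_prop) (fun n => integrable_dirac (by simp))
  simpa using this

/-- A tempered distribution whose Fourier transform is a smooth function of temperate growth
is of fast decrease. -/
theorem HasFourierTransform.isOfFastDecrease {D : 𝓢'(ℝ, ℂ)} {U : ℝ → ℂ}
    (hD : HasFourierTransform D U) (hU : U.HasTemperateGrowth) : IsOfFastDecrease D := by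
  intro f
  obtain ⟨φ, rfl⟩ := angularFourier_surjective f
  have hU' : (fun ξ => U (-ξ)).HasTemperateGrowth :=
    hU.comp Function.HasTemperateGrowth.id'.neg
  refine ⟨angularFourier (SchwartzMap.smulLeftCLM ℂ (fun ξ => U (-ξ)) φ), fun x => ?_⟩
  -- Reflecting and translating the transform of φ amounts to reflecting φ and multiplying it by
  -- e^{iξx}.
  set ψ : 𝓢(ℝ, ℂ) := SchwartzMap.smulLeftCLM ℂ (fun ξ : ℝ => Complex.exp (ξ * x * Complex.I))
    (SchwartzMap.compCLMOfContinuousLinearEquiv ℂ (ContinuousLinearEquiv.neg ℝ (M := ℝ)) φ)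
    with hψdef
  have hψ : ∀ ξ, ψ ξ = Complex.exp (ξ * x * Complex.I) * φ (-ξ) := fun ξ => by
    rw [hψdef, SchwartzMap.smulLeftCLM_apply_apply (hasTemperateGrowth_exp_mul_I x)]
    simp
  have hψf : reflectTranslate (angularFourier φ) x = angularFourier ψ := by
    ext y
    rw [reflectTranslate_apply, angularFourier_apply, angularFourier_apply,
      ← integral_neg_eq_self]
    refine integral_congr_ae (Eventually.of_forall fun ξ => ?_)
    simp only [hψ]
    rw [← mul_assoc, ← Complex.exp_add]
    congr 2
    push_cast
    ring
  rw [distConv, hψf, (hD ψ).2, angularFourier_apply, ← integral_neg_eq_self]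
  refine integral_congr_ae (Eventually.of_forall fun ξ => ?_)
  simp only [hψ, SchwartzMap.smulLeftCLM_apply_apply hU', neg_neg, smul_eq_mul]
  rw [mul_left_comm]
  congr 3
  push_cast
  ring

section

variable {ρ : Measure ℝ} [IsProbabilityMeasure ρ]

theorem integrable_comp_add (h : 𝓢(ℝ, ℂ)) (x : ℝ) : Integrable (fun z => h (x + z)) ρ :=
  Integrable.of_bound (by
    have := h.continuous
    exact (by fun_prop : Continuous _).aestronglyMeasurable) _
    (Eventually.of_forall fun z => SchwartzMap.norm_le_seminorm ℝ h (x + z))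

theorem integrable_prod_comp_add (h : 𝓢(ℝ, ℂ)) (ξ : ℝ) :
    Integrable (fun p : ℝ × ℝ => Complex.exp (-(Complex.I * ξ * p.2)) * h (p.2 + p.1))
      (ρ.prod volume) := by
  have hc := h.continuous
  have hn : ∀ x : ℝ, ‖Complex.exp (-(Complex.I * ξ * x))‖ = 1 := fun x => by
    have : -(Complex.I * (ξ : ℂ) * (x : ℂ)) = ((-(ξ * x) : ℝ) : ℂ) * Complex.I := by
      push_cast
      ring
    rw [this, Complex.norm_exp_ofReal_mul_I]
  rw [integrable_prod_iff (by exact (by fun_prop : Continuous _).aestronglyMeasurable)]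
  constructor
  · refine Eventually.of_forall fun z => ?_
    refine (h.integrable.comp_add_right z).mono
      (by exact (by fun_prop : Continuous _).aestronglyMeasurable) (Eventually.of_forall fun x => ?_)
    rw [norm_mul, hn, one_mul]
  · simp_rw [norm_mul, hn, one_mul]
    simp_rw [integral_add_right_eq_self (fun x => ‖h x‖)]
    exact integrable_const _

theorem integral_exp_mul_integral_comp_add (h : 𝓢(ℝ, ℂ)) (ξ : ℝ) :
    ∫ x : ℝ, Complex.exp (-(Complex.I * ξ * x)) * ∫ z, h (x + z) ∂ρ =
      charFun ρ ξ * angularFourier h ξ := by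
  simp_rw [← integral_const_mul]
  rw [← integral_integral_swap (f := fun z x : ℝ =>
    Complex.exp (-(Complex.I * ξ * x)) * h (x + z)) (integrable_prod_comp_add h ξ),
    charFun_apply_real, ← integral_mul_const]
  refine integral_congr_ae (Eventually.of_forall fun z => ?_)
  simp only
  rw [angularFourier_apply, ← integral_const_mul, ← integral_add_right_eq_self
    (fun x : ℝ => Complex.exp (ξ * z * Complex.I) *
      (Complex.exp (-(Complex.I * ξ * x)) * h x)) z]
  refine integral_congr_ae (Eventually.of_forall fun x => ?_)
  simp only
  rw [← mul_assoc, ← Complex.exp_add]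
  congr 2
  push_cast
  ring

theorem integrable_exp_mul_integral_comp_add (h : 𝓢(ℝ, ℂ)) (ξ : ℝ) :
    Integrable fun x : ℝ => Complex.exp (-(Complex.I * ξ * x)) * ∫ z, h (x + z) ∂ρ := by
  simp_rw [← integral_const_mul]
  exact (integrable_prod_comp_add h ξ).integral_prod_right

theorem integrable_exp_mul (h : 𝓢(ℝ, ℂ)) (ξ : ℝ) :
    Integrable fun x : ℝ => Complex.exp (-(Complex.I * ξ * x)) * h x := by
  -- For the Dirac mass at 0 the inner average is h itself.
  simpa using integrable_exp_mul_integral_comp_add (ρ := Measure.dirac 0) h ξ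

theorem angularFourier_derivCLM (f : 𝓢(ℝ, ℂ)) (ξ : ℝ) :
    angularFourier (SchwartzMap.derivCLM ℂ ℂ f) ξ = Complex.I * ξ * angularFourier f ξ := by
  have h1 : ∀ g : 𝓢(ℝ, ℂ), angularFourier g ξ = 𝓕 (g : ℝ → ℂ) (ξ * (1 / (2 * Real.pi))) :=
    fun g => by simp [angularFourier, dilation, SchwartzMap.fourier_coe]
  have hd : ⇑(SchwartzMap.derivCLM ℂ ℂ f) = deriv f :=
    funext fun x => SchwartzMap.derivCLM_apply ℂ f x
  have hi : Integrable (deriv f) := hd ▸ (SchwartzMap.derivCLM ℂ ℂ f).integrable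
  rw [h1, h1, hd, Real.fourier_deriv f.integrable f.differentiable hi]
  have hpi : (Real.pi : ℂ) ≠ 0 := by exact_mod_cast Real.pi_ne_zero
  simp only [smul_eq_mul]
  push_cast
  field_simp

/-- The reason for testing on derivatives: the half-line part of the convolution collapses to a
boundary term. -/
theorem integral_Iic_derivCLM_comp_sub (f : 𝓢(ℝ, ℂ)) (x : ℝ) :
    ∫ y in Set.Iic 0, SchwartzMap.derivCLM ℂ ℂ f (x - y) = -f x := by
  have hd : ∀ y ∈ Set.Iic (0 : ℝ), HasDerivAt (fun y => -f (x - y))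
      (SchwartzMap.derivCLM ℂ ℂ f (x - y)) y := fun y _ => by
    have h1 : HasDerivAt (fun y : ℝ => x - y) (-1) y := (hasDerivAt_id y).const_sub x
    exact ((f.hasDerivAt (x - y)).scomp y h1).neg.congr_deriv
      (by simp [SchwartzMap.derivCLM_apply])
  have ht : Tendsto (fun y => -f (x - y)) atBot (𝓝 0) := by
    have h0 : Tendsto f atTop (𝓝 0) := by
      refine f.tendsto_cocompact.mono_left ?_
      rw [cocompact_eq_atBot_atTop]
      exact le_sup_right
    have h1 : Tendsto (fun y : ℝ => x - y) atBot atTop :=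
      tendsto_const_nhds.add_atTop tendsto_neg_atBot_atTop |>.congr fun y => by ring
    simpa using (h0.comp h1).neg
  rw [integral_Iic_of_hasDerivAt_of_tendsto' hd
    (((SchwartzMap.derivCLM ℂ ℂ f).integrable.comp_sub_left x).integrableOn) ht]
  simp

/-- The renewal equation in Fourier space: if `g = (G - T_λ) ⋆ f'`, then
`(1 - ρ̂(-iξ)) ĝ(iξ) = (iξ + (1 - ρ̂(-iξ)) / λ) f̂(iξ)`. -/
theorem renewal_equation_fourier (hdrift : 0 < drift ρ) {D : 𝓢'(ℝ, ℂ)}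
    (hD : IsDifference D (greenKernel ρ) (halfLine (drift ρ))) {f g : 𝓢(ℝ, ℂ)}
    (hg : ∀ x, g x = distConv D (SchwartzMap.derivCLM ℂ ℂ f) x) (ξ : ℝ) :
    (1 - charFun ρ ξ) * angularFourier g ξ =
      (Complex.I * ξ + (drift ρ : ℂ)⁻¹ * (1 - charFun ρ ξ)) * angularFourier f ξ := by
  set f' := SchwartzMap.derivCLM ℂ ℂ f
  set a : ℂ := (drift ρ : ℂ)⁻¹
  have hA : ∀ x, ∫ y, f' (x - y) ∂(greenKernel ρ) = g x - a * f x := fun x => by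
    have h := (hD (reflectTranslate f' x)).2.2
    simp only [reflectTranslate_apply] at h
    rw [hg, distConv, h, integral_halfLine hdrift, integral_Iic_derivCLM_comp_sub]
    ring
  -- The renewal equation before Fourier transform: G ⋆ f' equals g - f/λ, and its average over
  -- translates by ρ differs from it by f'.
  have hE : ∀ x, g x - ∫ z, g (x + z) ∂ρ = f' x + a * (f x - ∫ z, f (x + z) ∂ρ) := fun x => by
    have hi : Integrable (fun y => f' (x - y)) (greenKernel ρ) := by
      simpa only [reflectTranslate_apply] using (hD (reflectTranslate f' x)).1
    have h1 := integral_greenKernel_eq (f'.continuous.comp (continuous_sub_left x)) hi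
    simp only [Function.comp_apply] at h1
    have h2 : ∀ z, ∫ y, f' (x - (y - z)) ∂(greenKernel ρ) = g (x + z) - a * f (x + z) :=
      fun z => by
        rw [← hA]
        congr! 3
        ring
    simp_rw [h2] at h1
    rw [integral_sub (integrable_comp_add g x) ((integrable_comp_add f x).const_mul a),
      integral_const_mul, hA, sub_zero] at h1
    linear_combination h1
  have hF : ∫ x : ℝ, Complex.exp (-(Complex.I * ξ * x)) * (g x - ∫ z, g (x + z) ∂ρ) =
      ∫ x : ℝ, Complex.exp (-(Complex.I * ξ * x)) *
        (f' x + a * (f x - ∫ z, f (x + z) ∂ρ)) := by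
    simp_rw [hE]
  simp only [mul_add, mul_sub, mul_left_comm _ a] at hF
  have hi : Integrable fun x : ℝ => a * (Complex.exp (-(Complex.I * ξ * x)) * f x) -
      a * (Complex.exp (-(Complex.I * ξ * x)) * ∫ z, f (x + z) ∂ρ) :=
    ((integrable_exp_mul f ξ).const_mul a).sub
      ((integrable_exp_mul_integral_comp_add f ξ).const_mul a)
  rw [integral_sub (integrable_exp_mul g ξ) (integrable_exp_mul_integral_comp_add g ξ),
    integral_add (integrable_exp_mul f' ξ) hi,
    integral_sub ((integrable_exp_mul f ξ).const_mul a)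
      ((integrable_exp_mul_integral_comp_add f ξ).const_mul a),
    integral_const_mul, integral_const_mul, integral_exp_mul_integral_comp_add,
    integral_exp_mul_integral_comp_add, ← angularFourier_apply, ← angularFourier_apply,
    ← angularFourier_apply, angularFourier_derivCLM] at hF
  linear_combination hF

theorem isWeaklyDiophantine_of_isOfFastDecrease (hdrift : 0 < drift ρ) {D : 𝓢'(ℝ, ℂ)}
    (hD : IsDifference D (greenKernel ρ) (halfLine (drift ρ))) (hfast : IsOfFastDecrease D) :
    IsWeaklyDiophantine ρ := by
  obtain ⟨N, R, h⟩ := exists_one_le_pow_mul_of_schwartz_le (w := fun ξ => ‖1 - charFun ρ ξ‖)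
    -- As |1 - P| ≤ 2, this radius forces |iξ + (1 - P)/λ| ≥ |ξ| - 2/λ ≥ 1.
    (R := 1 + (drift ρ)⁻¹ * 2) (fun _ => norm_nonneg _) (fun φ => by
      obtain ⟨f, rfl⟩ := angularFourier_surjective φ
      obtain ⟨g, hg⟩ := hfast (SchwartzMap.derivCLM ℂ ℂ f)
      refine ⟨SchwartzMap.seminorm ℝ 0 0 (angularFourier g), fun ξ hξ => ?_⟩
      have hw : ‖1 - charFun ρ ξ‖ ≤ 2 := norm_one_sub_charFun_le_two
      have h1 : 1 ≤ ‖Complex.I * ξ + (drift ρ : ℂ)⁻¹ * (1 - charFun ρ ξ)‖ := by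
        have h2 := norm_sub_le (Complex.I * ξ + (drift ρ : ℂ)⁻¹ * (1 - charFun ρ ξ))
          ((drift ρ : ℂ)⁻¹ * (1 - charFun ρ ξ))
        rw [add_sub_cancel_right, norm_mul, norm_mul (_⁻¹), Complex.norm_I, one_mul, norm_inv,
          Complex.norm_real, Complex.norm_real, Real.norm_eq_abs, Real.norm_of_nonneg hdrift.le]
          at h2
        have h3 : (drift ρ)⁻¹ * ‖1 - charFun ρ ξ‖ ≤ (drift ρ)⁻¹ * 2 := by gcongr
        linarith
      have h2 := congrArg norm (renewal_equation_fourier hdrift hD hg ξ)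
      rw [norm_mul, norm_mul] at h2
      calc ‖angularFourier f ξ‖ ≤ _ := le_mul_of_one_le_left (norm_nonneg _) h1
        _ = _ := h2.symm
        _ ≤ ‖1 - charFun ρ ξ‖ * SchwartzMap.seminorm ℝ 0 0 (angularFourier g) := by
          gcongr
          exact SchwartzMap.norm_le_seminorm ℝ _ _
        _ = _ := mul_comm _ _)
  exact isWeaklyDiophantine_iff.2 ⟨N, 1, R, one_pos, h⟩

theorem exists_isDifference (hexp : HasExponentialMoment ρ) (hdrift : 0 < drift ρ) :
    ∃ D : 𝓢'(ℝ, ℂ), IsDifference D (greenKernel ρ) (halfLine (drift ρ)) := by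
  have := hasTemperateGrowth_greenKernel hexp hdrift
  have := hasTemperateGrowth_halfLine (drift ρ)
  refine ⟨(greenKernel ρ).toTemperedDistribution - (halfLine (drift ρ)).toTemperedDistribution,
    fun φ => ⟨φ.integrable, φ.integrable, ?_⟩⟩
  rfl

end

end Renewal

end

theorem mainTheorem2 (ρ : Measure ℝ) [IsProbabilityMeasure ρ]
    (hexp : Renewal.HasExponentialMoment ρ) (hdrift : 0 < Renewal.drift ρ) :
    ∃ D : 𝓢'(ℝ, ℂ),
      Renewal.IsDifference D (Renewal.greenKernel ρ) (Renewal.halfLine (Renewal.drift ρ)) ∧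
      (Renewal.IsOfFastDecrease D ↔ Renewal.IsWeaklyDiophantine ρ) ∧
      (Renewal.IsWeaklyDiophantine ρ →
        ∃ U : ℝ → ℂ, U.HasTemperateGrowth ∧
          (∀ ξ : ℝ, ξ ≠ 0 →
            1 - Renewal.laplace ρ (-(Complex.I * (ξ : ℂ))) ≠ 0 ∧
            U ξ = 1 / (1 - Renewal.laplace ρ (-(Complex.I * (ξ : ℂ))))
              + 1 / ((Renewal.drift ρ : ℂ) * (Complex.I * (ξ : ℂ)))) ∧
          Renewal.HasFourierTransform D U) := by
  obtain ⟨D, hD⟩ := Renewal.exists_isDifference hexp hdrift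
  refine ⟨D, hD, ⟨Renewal.isWeaklyDiophantine_of_isOfFastDecrease hdrift hD, fun hρ =>
    (hρ.hasFourierTransform hexp hdrift hD).isOfFastDecrease
      (hρ.hasTemperateGrowth_renewalSymbol hexp hdrift)⟩, fun hρ =>
    ⟨Renewal.renewalSymbol ρ, hρ.hasTemperateGrowth_renewalSymbol hexp hdrift, fun ξ hξ => ?_,
      hρ.hasFourierTransform hexp hdrift hD⟩⟩
  rw [Renewal.laplace_neg_I_mul]
  exact ⟨sub_ne_zero.2 (hρ.charFun_ne_one hξ).symm, hρ.renewalSymbol_eq hexp hdrift hξ⟩
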